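/- Let $X_0$ and $X_1$ be rearrangement invariant (r.i.) spaces on $[0,1]$, where, as usual, r.i. spaces are nonzero Banach function lattices whose norm depends only on the distribution of $|f|$ and which are separable or maximal ($X=X''$ with equal norms, $X'$ being the K\"othe dual). Suppose that $X_0\subset X_1$ and that this embedding is strict: whenever $(x_n)$ is bounded in $X_0$ and $m(\operatorname{supp}x_n)\to 0$ ($m$ is Lebesgue measure), one has $\|x_n\|_{X_1}\to 0$. Let $(m_n)_{n\ge 1}$ be an increasing sequence of reals with $m_1\ge 2$ and $$m_n^{-1}\sum_{i=1}^{n-1}m_i+m_n\sum_{i=n+1}^{\infty}m_i^{-1}<2^{-n-1},\qquad n=1,2,\dots$$ For $\alpha,\beta>0$ and $a\in X_0+X_1$ put $k(\alpha,\beta,a)=\inf\{\alpha\|a_0\|_{X_0}+\beta\|a_1\|_{X_1}: a=a_0+a_1,\ a_i\in X_i\}$. For a Banach space $E$ with a normalized $1$-unconditional basis $(e_n)$, let $W_E^K(X_0,X_1)$ be the space of all $a\in X_0+X_1$ for which $\sum_n k(m_n^{-1},m_n,a)e_n$ converges in $E$, with the norm $\|a\|=\big\|\sum_n k(m_n^{-1},m_n,a)e_n\big\|_E$.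 Let $1\le p\le\infty$, and let $W=W_{l_p}^K(X_0,X_1)$ if $p<\infty$ and $W=W_{c_0}^K(X_0,X_1)$ if $p=\infty$ (with the unit vector bases). Then $W$ is an r.i. space on $[0,1]$ (in the above sense), and (i) $W$ is $p$-disjointly homogeneous ($p$-DH): every sequence of pairwise disjoint functions of norm one in $W$ has a subsequence equivalent to the unit vector basis of $l_p$ (of $c_0$ if $p=\infty$); (ii) $W$ is disjointly complemented (DC): every sequence of pairwise disjoint functions in $W$ has a subsequence whose closed linear span is complemented in $W$. -/

import Mathlib

open MeasureTheory Filter Topology Set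
open scoped ENNReal ZeroAtInfty

noncomputable section

/-- Lebesgue measure on the unit interval `[0,1]`. -/
abbrev leb01 : Measure ℝ := volume.restrict (Icc (0 : ℝ) 1)

/-- Equivalence classes (modulo a.e. equality) of real measurable functions on `[0,1]`. -/
abbrev L0 : Type := ℝ →ₘ[leb01] ℝ

/-- A Banach function lattice on `[0,1]`: a linear space of (classes of) measurable functions with
a complete norm which has the ideal property. -/
structure BanachFunctionLattice where
  /-- the linear space of functions -/
  carrier : Submodule ℝ L0
  /-- the norm: a seminorm which, by the next field, is a norm -/
  nrm : Seminorm ℝ carrier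
  eq_zero_of_nrm : ∀ x, nrm x = 0 → x = 0
  complete : ∀ u : ℕ → carrier,
    (∀ ε > 0, ∃ N, ∀ i ≥ N, ∀ j ≥ N, nrm (u i - u j) < ε) →
      ∃ x, Tendsto (fun n => nrm (u n - x)) atTop (𝓝 0)
  ideal : ∀ (f g : L0) (hg : g ∈ carrier), |f| ≤ |g| →
    ∃ hf : f ∈ carrier, nrm ⟨f, hf⟩ ≤ nrm ⟨g, hg⟩

namespace BanachFunctionLattice

/-- The type of elements of a Banach function lattice, as a normed space. -/
def Elem (X : BanachFunctionLattice) : Type := X.carrier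

instance (X : BanachFunctionLattice) : AddCommGroup X.Elem :=
  inferInstanceAs (AddCommGroup X.carrier)

instance (X : BanachFunctionLattice) : Module ℝ X.Elem :=
  inferInstanceAs (Module ℝ X.carrier)

/-- An element of the lattice as a (class of a) function. -/
def Elem.toFun {X : BanachFunctionLattice} (x : X.Elem) : L0 := Subtype.val (p := (· ∈ X.carrier)) x

theorem Elem.mem {X : BanachFunctionLattice} (x : X.Elem) : x.toFun ∈ X.carrier :=
  Subtype.property (p := (· ∈ X.carrier)) x

/-- A function that belongs to the lattice, as an element of it. -/
def mk' (X : BanachFunctionLattice) (f : L0) (hf : f ∈ X.carrier) : X.Elem :=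
  (⟨f, hf⟩ : X.carrier)

instance (X : BanachFunctionLattice) : NormedAddCommGroup X.Elem :=
  AddGroupNorm.toNormedAddCommGroup
    { toFun := fun x : X.Elem => X.nrm x
      map_zero' := map_zero X.nrm
      add_le' := fun x y => map_add_le_add X.nrm x y
      neg' := fun x => map_neg_eq_map X.nrm x
      eq_zero_of_map_eq_zero' := fun x h => X.eq_zero_of_nrm x h }

theorem norm_def (X : BanachFunctionLattice) (x : X.Elem) : ‖x‖ = X.nrm x := rfl

instance (X : BanachFunctionLattice) : NormedSpace ℝ X.Elem where
  norm_smul_le c x := le_of_eq (map_smul_eq_mul X.nrm c x)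

/-- The norm extended by `∞` to functions outside the lattice. -/
def extNorm (X : BanachFunctionLattice) (f : L0) : ℝ≥0∞ :=
  open Classical in if h : f ∈ X.carrier then ENNReal.ofReal ‖X.mk' f h‖ else ∞

/-- A sequence of pairwise disjoint functions. -/
def DisjointSeq {X : BanachFunctionLattice} (x : ℕ → X.Elem) : Prop :=
  ∀ i j, i ≠ j → |(x i).toFun| ⊓ |(x j).toFun| = 0

end BanachFunctionLattice

/-- The norm `sup {∫ |f g| : N g ≤ 1}` of the Köthe dual of the space with the (extended)
norm `N`. -/
def kotheDualNorm (N : L0 → ℝ≥0∞) (f : L0) : ℝ≥0∞ :=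
  ⨆ (g : L0) (_ : N g ≤ 1), ∫⁻ t, ‖f t * g t‖ₑ ∂leb01

/-- Two functions on `[0,1]` are equimeasurable: their moduli have the same distribution. -/
def Equimeasurable (f g : L0) : Prop :=
  ∀ τ : ℝ, 0 < τ → leb01 {t | τ < |f t|} = leb01 {t | τ < |g t|}

/-- A (nonzero) rearrangement invariant space on `[0,1]`. As usual, it is required to be separable
or maximal, the latter meaning that it coincides, with the same norm, with its second Köthe
dual. -/
structure RISpace extends BanachFunctionLattice where
  nontrivial : carrier ≠ ⊥
  rearrangement : ∀ (f g : L0) (hg : g ∈ carrier), Equimeasurable f g →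
    ∃ hf : f ∈ carrier, nrm ⟨f, hf⟩ = nrm ⟨g, hg⟩
  separable_or_maximal : TopologicalSpace.SeparableSpace toBanachFunctionLattice.Elem ∨
    kotheDualNorm (kotheDualNorm toBanachFunctionLattice.extNorm) =
      toBanachFunctionLattice.extNorm

/-- `X₀ ⊆ X₁` and the embedding is strict: if `(xₙ)` is bounded in `X₀` and the measures of the
supports tend to `0`, then `‖xₙ‖_{X₁} → 0`. -/
def StrictlyEmbedded (X₀ X₁ : BanachFunctionLattice) : Prop :=
  ∃ h : X₀.carrier ≤ X₁.carrier, ∀ x : ℕ → X₀.Elem, (∃ C : ℝ, ∀ n, ‖x n‖ ≤ C) →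
    Tendsto (fun n => leb01 {t | (x n).toFun t ≠ 0}) atTop (𝓝 0) →
      Tendsto (fun n => ‖X₁.mk' (x n).toFun (h (x n).mem)‖) atTop (𝓝 0)

/-- The Peetre `K`-functional `k(α, β, a; X₀, X₁)`, for `a ∈ X₀ + X₁` and `α, β > 0`. -/
def kFunctional (X₀ X₁ : BanachFunctionLattice) (α β : ℝ) (a : L0) : ℝ :=
  sInf {r | ∃ (a₀ : X₀.Elem) (a₁ : X₁.Elem),
    a = a₀.toFun + a₁.toFun ∧ r = α * ‖a₀‖ + β * ‖a₁‖}

section LionsPeetre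

variable {E : Type*} [NormedAddCommGroup E] [NormedSpace ℝ E]

/-- The set of elements of the Lions-Peetre space `W_E^K(X₀, X₁, (αₙ), (βₙ))`, where `E` carries the
`1`-unconditional normalized basis `(eₙ)`: those `a ∈ X₀ + X₁` for which the series
`∑ k(αₙ, βₙ, a) eₙ` converges in `E` (convergence is automatically unconditional). -/
def lionsPeetreSet (e : ℕ → E) (X₀ X₁ : BanachFunctionLattice) (α β : ℕ → ℝ) : Set L0 :=
  {a | a ∈ X₀.carrier ⊔ X₁.carrier ∧
    Summable (fun n => kFunctional X₀ X₁ (α n) (β n) a • e n)}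

/-- The norm `‖∑ k(αₙ, βₙ, a) eₙ‖_E` of the Lions-Peetre space. -/
def lionsPeetreNorm (e : ℕ → E) (X₀ X₁ : BanachFunctionLattice) (α β : ℕ → ℝ) (a : L0) : ℝ :=
  ‖∑' n, kFunctional X₀ X₁ (α n) (β n) a • e n‖

/-- `W` is the Lions-Peetre space `W_E^K(X₀, X₁, (αₙ), (βₙ))`: same elements, same norm. -/
def IsLionsPeetre (W : BanachFunctionLattice) (e : ℕ → E) (X₀ X₁ : BanachFunctionLattice)
    (α β : ℕ → ℝ) : Prop :=
  (W.carrier : Set L0) = lionsPeetreSet e X₀ X₁ α β ∧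
    ∀ a : W.Elem, ‖a‖ = lionsPeetreNorm e X₀ X₁ α β a.toFun

end LionsPeetre

/-- Equivalence of two sequences in (possibly different) normed spaces. -/
def EquivalentSeq {E F : Type*} [NormedAddCommGroup E] [NormedSpace ℝ E]
    [NormedAddCommGroup F] [NormedSpace ℝ F] (x : ℕ → E) (y : ℕ → F) : Prop :=
  ∃ c C : ℝ, 0 < c ∧ 0 < C ∧ ∀ (s : Finset ℕ) (a : ℕ → ℝ),
    c * ‖∑ n ∈ s, a n • y n‖ ≤ ‖∑ n ∈ s, a n • x n‖ ∧
      ‖∑ n ∈ s, a n • x n‖ ≤ C * ‖∑ n ∈ s, a n • y n‖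

/-- The unit vector basis of `ℓ_p`. -/
def lpUnit (p : ℝ≥0∞) (n : ℕ) : lp (fun _ : ℕ => ℝ) p := lp.single p n (1 : ℝ)

/-- The unit vector basis of `c₀`. -/
def c0Unit (n : ℕ) : C₀(ℕ, ℝ) where
  toFun := Pi.single n 1
  continuous_toFun := continuous_of_discreteTopology
  zero_at_infty' := by
    rw [cocompact_eq_cofinite, Nat.cofinite_eq_atTop]
    refine tendsto_const_nhds.congr' ?_
    filter_upwards [eventually_gt_atTop n] with k hk
    simp [Pi.single_apply, hk.ne']

namespace BanachFunctionLattice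

/-- Every normalized disjoint sequence has a subsequence equivalent to `(eₙ)`. -/
def DisjointlyHomogeneousTo {E : Type*} [NormedAddCommGroup E] [NormedSpace ℝ E]
    (X : BanachFunctionLattice) (e : ℕ → E) : Prop :=
  ∀ x : ℕ → X.Elem, (∀ n, ‖x n‖ = 1) → DisjointSeq x →
    ∃ φ : ℕ → ℕ, StrictMono φ ∧ EquivalentSeq (x ∘ φ) e

/-- `p`-disjointly homogeneous lattices, `1 ≤ p ≤ ∞` (with `c₀` in place of `ℓ_∞`). -/
def IsPDH (p : ℝ≥0∞) [Fact (1 ≤ p)] (X : BanachFunctionLattice) : Prop :=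
  (p ≠ ∞ → X.DisjointlyHomogeneousTo (lpUnit p)) ∧
    (p = ∞ → X.DisjointlyHomogeneousTo c0Unit)

/-- Disjointly complemented lattices: every disjoint sequence has a subsequence whose closed linear
span is complemented, that is, the range of a bounded projection. -/
def IsDC (X : BanachFunctionLattice) : Prop :=
  ∀ x : ℕ → X.Elem, DisjointSeq x → ∃ φ : ℕ → ℕ, StrictMono φ ∧
    (Submodule.span ℝ (range (x ∘ φ))).topologicalClosure.ClosedComplemented

end BanachFunctionLattice

/-- The sequences `m₁, m₂, …` of weights (`m n` stands for `m_{n+1}`): increasing, `m₁ ≥ 2` and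
`mₙ⁻¹ ∑_{i<n} mᵢ + mₙ ∑_{i>n} mᵢ⁻¹ < 2^{-n-1}` for all `n ≥ 1`. -/
structure AdmissibleWeights (m : ℕ → ℝ) : Prop where
  strictMono : StrictMono m
  two_le : 2 ≤ m 0
  summable : Summable fun i => (m i)⁻¹
  bound : ∀ n, (m n)⁻¹ * ∑ i ∈ Finset.range n, m i + m n * ∑' i, (m (n + 1 + i))⁻¹
    < (1 / 2 : ℝ) ^ (n + 2)

end

/-! The bases of $l_p$ and $c_0$ enter only through `PerfectlyHomogeneous`: normalized,
1-unconditional, and isometric to each of their normalized block sequences. For a finite index set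
$s$, let `partialNorm` of $a$ over $s$ be the norm of $\sum_{n\in s}k(m_n^{-1},m_n,a)e_n$. On $W$
the norm is the supremum of these, and membership in $W$ is a Cauchy criterion for them.

The key fact is `tendsto_normOf_of_wNorm_le`: if $(a_k)$ is bounded in $W$ and its supports shrink,
then $\|a_k\|_{X_1}\to 0$. Indeed, for a fixed large $n$, a nearly optimal decomposition
$a_k=b_k+c_k$ has $\|c_k\|_{X_1}\lesssim m_n^{-1}$, while $b_k$ is bounded in $X_0$ and may be cut
off to the support of $a_k$; strictness of the embedding makes the cut $b_k$ small in $X_1$. Hence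
every fixed partial norm of $a_k$ tends to $0$.

For disjoint normalized sequences a gliding hump (`exists_subsequence_blocks`) now gives a
subsequence $(v_j)$ concentrated, up to $2^{-j-1}$, on disjoint blocks $I_j$ of coordinates. The
lattice structure and homogeneity of the basis yield `lower_estimate` and `upper_estimate`, hence
$p$-DH. For DC, take functionals norming $v_j$ for the partial norm over $I_j$, composed with
restriction to the support of $v_j$; the same estimates bound the resulting projection
(`closedComplemented_of_blocks`).

That $W$ is r.i. has two sides. The K-functional depends only on the distribution, because
equimeasurable functions dominate each other's rearrangements up to a small constant
(`Equimeasurable.exists_le_comp`). The key fact also makes the norm of $W$ absolutely continuous, so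
$W$ is separable. -/

noncomputable section

/-! ### Measure preserving maps between equimeasurable functions. -/

open ProbabilityTheory unitInterval in
/-- A diffuse probability measure on the line is mapped by its distribution function to the
uniform distribution. -/
theorem exists_map_eq_uniform (μ : Measure ℝ) [IsProbabilityMeasure μ] [NullSingletonClass μ] :
    ∃ φ : ℝ → I, Measurable φ ∧ μ.map φ = volume := by
  have hcont : Continuous (cdf μ) := by
    rw [continuous_iff_continuousAt]
    intro x
    rw [(cdf μ).mono.continuousAt_iff_leftLim_eq_rightLim, (cdf μ).rightLim_eq]
    have h := (cdf μ).measure_singleton x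
    rw [measure_cdf, measure_singleton] at h
    have h1 := ENNReal.ofReal_eq_zero.1 h.symm
    exact le_antisymm ((cdf μ).mono.leftLim_le le_rfl) (by linarith)
  have hmeas : Measurable (cdf μ) := (cdf μ).mono.measurable
  have key : ∀ s : ℝ, 0 ≤ s → s < 1 → μ {t | cdf μ t ≤ s} = ENNReal.ofReal s := by
    have key' : ∀ s : ℝ, 0 < s → s < 1 → μ {t | cdf μ t ≤ s} = ENNReal.ofReal s := by
      intro s hs0 hs1
      obtain ⟨u, hu⟩ := ((tendsto_cdf_atTop μ).eventually (lt_mem_nhds hs1)).exists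
      obtain ⟨v, hv⟩ := ((tendsto_cdf_atBot μ).eventually (gt_mem_nhds hs0)).exists
      -- The sublevel set is a half-line whose endpoint `T` satisfies `cdf μ T = s` by continuity.
      have hbdd : BddAbove {t | cdf μ t ≤ s} :=
        ⟨u, fun t ht => le_of_lt ((cdf μ).mono.reflect_lt (lt_of_le_of_lt ht hu))⟩
      have hne : {t | cdf μ t ≤ s}.Nonempty := ⟨v, hv.le⟩
      have hcl : IsClosed {t | cdf μ t ≤ s} := isClosed_le hcont continuous_const
      set T := sSup {t | cdf μ t ≤ s} with hT
      have hTmem : cdf μ T ≤ s := hcl.csSup_mem hne hbdd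
      have heq : {t | cdf μ t ≤ s} = Iic T := by
        ext t
        exact ⟨fun h => le_csSup hbdd h, fun h => ((cdf μ).mono h).trans hTmem⟩
      rw [heq, ← ofReal_cdf]
      congr 1
      refine le_antisymm hTmem ?_
      refine ge_of_tendsto (hcont.continuousAt.tendsto.mono_left
        (nhdsWithin_le_nhds (s := Ioi T))) ?_
      filter_upwards [self_mem_nhdsWithin] with t ht
      by_contra! hlt
      exact absurd (le_csSup hbdd (show t ∈ {t | cdf μ t ≤ s} from hlt.le)) (not_le.2 ht)
    intro s hs0 hs1
    rcases hs0.eq_or_lt with rfl | hs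
    -- At level zero the sublevel set may be empty, so it is squeezed between small positive levels.
    · refine le_antisymm ?_ (by simp)
      refine ENNReal.le_of_forall_pos_le_add fun ε hε _ => ?_
      have hm : 0 < min (ε : ℝ) (1 / 2) := lt_min hε (by norm_num)
      calc μ {t | cdf μ t ≤ 0} ≤ μ {t | cdf μ t ≤ min (ε : ℝ) (1 / 2)} :=
            measure_mono fun t ht => le_trans ht hm.le
        _ = ENNReal.ofReal (min (ε : ℝ) (1 / 2)) :=
            key' _ hm (lt_of_le_of_lt (min_le_right _ _) (by norm_num))
        _ ≤ ENNReal.ofReal 0 + ε := by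
            rw [ENNReal.ofReal_zero, zero_add, ← ENNReal.ofReal_coe_nnreal]
            exact ENNReal.ofReal_le_ofReal (min_le_left _ _)
    · exact key' s hs hs1
  have hI : ∀ t, cdf μ t ∈ I := fun t => ⟨cdf_nonneg μ t, cdf_le_one μ t⟩
  refine ⟨fun t => ⟨cdf μ t, hI t⟩, hmeas.subtype_mk, ?_⟩
  have : IsProbabilityMeasure (μ.map fun t => (⟨cdf μ t, hI t⟩ : I)) :=
    Measure.isProbabilityMeasure_map hmeas.subtype_mk.aemeasurable
  refine Measure.ext_of_Iic _ _ fun s => ?_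
  rw [Measure.map_apply hmeas.subtype_mk measurableSet_Iic, unitInterval.volume_Iic]
  rcases s.2.2.eq_or_lt with h1 | h1
  · have : (fun t => (⟨cdf μ t, hI t⟩ : I)) ⁻¹' Iic s = univ := by
      ext t
      simp only [mem_preimage, mem_Iic, mem_univ, iff_true, ← Subtype.coe_le_coe, h1]
      exact cdf_le_one μ t
    rw [this, measure_univ, h1, ENNReal.ofReal_one]
  · exact key s s.2.1 h1

/-- Two sets of equal measure are linked by a measure preserving map. -/
theorem exists_map_restrict_eq {A B : Set ℝ} (hAB : leb01 A = leb01 B) :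
    ∃ τ : ℝ → ℝ, Measurable τ ∧ (leb01.restrict A).map τ = leb01.restrict B := by
  by_cases h0 : leb01 A = 0
  · refine ⟨id, measurable_id, ?_⟩
    rw [Measure.restrict_eq_zero.2 h0, Measure.restrict_eq_zero.2 (hAB ▸ h0), Measure.map_zero]
  have hA : IsProbabilityMeasure (ProbabilityTheory.cond leb01 A) :=
    ProbabilityTheory.cond_isProbabilityMeasure h0
  have hB : IsProbabilityMeasure (ProbabilityTheory.cond leb01 B) :=
    ProbabilityTheory.cond_isProbabilityMeasure (hAB ▸ h0)
  have hAn : NullSingletonClass (ProbabilityTheory.cond leb01 A) :=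
    ⟨fun x => ProbabilityTheory.cond_absolutelyContinuous (measure_singleton x)⟩
  obtain ⟨φ, hφ, hφm⟩ := exists_map_eq_uniform (ProbabilityTheory.cond leb01 A)
  obtain ⟨ψ, hψ, hψm⟩ := (ProbabilityTheory.cond leb01 B).exists_measurable_map_eq
  -- The uniform distribution is the intermediary: `φ` carries the normalized measure on `A` to it,
  -- and `ψ` carries it to the one on `B`.
  refine ⟨ψ ∘ φ, hψ.comp hφ, ?_⟩
  have key : (ProbabilityTheory.cond leb01 A).map (ψ ∘ φ) = ProbabilityTheory.cond leb01 B := by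
    rw [← Measure.map_map hψ hφ, hφm, hψm]
  have hc : ∀ C : Set ℝ, leb01 C ≠ 0 →
      leb01.restrict C = leb01 C • ProbabilityTheory.cond leb01 C := by
    intro C hC
    rw [ProbabilityTheory.cond, smul_smul, ENNReal.mul_inv_cancel hC (measure_ne_top _ _),
      one_smul]
  rw [hc A h0, Measure.map_smul, key, hAB, ← hc B (hAB ▸ h0)]

/-- Two countably valued functions with the same distribution differ by a measure preserving
change of variables. -/
theorem exists_measurePreserving_comp_eq {L L' : ℝ → ℕ} (hL : Measurable L) (hL' : Measurable L')
    (h : ∀ n, leb01 (L' ⁻¹' {n}) = leb01 (L ⁻¹' {n})) :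
    ∃ σ : ℝ → ℝ, MeasurePreserving σ leb01 leb01 ∧ ∀ᵐ t ∂leb01, L (σ t) = L' t := by
  choose τ hτ hτm using fun n => exists_map_restrict_eq (h n)
  have hσ : Measurable fun t => τ (L' t) t :=
    (measurable_from_prod_countable_right (f := fun p : ℕ × ℝ => τ p.1 p.2) hτ).comp
      (hL'.prodMk measurable_id)
  have hsum : ∀ M : ℝ → ℕ, Measurable M →
      leb01 = Measure.sum fun n => leb01.restrict (M ⁻¹' {n}) := by
    intro M hM
    rw [← Measure.restrict_iUnion (fun i j hij => ?_) fun n => hM (measurableSet_singleton n)]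
    · have : (⋃ n, M ⁻¹' {n}) = univ := by ext; simp
      rw [this, Measure.restrict_univ]
    · exact Disjoint.preimage _ (by simpa using hij)
  have hpiece : ∀ n, (leb01.restrict (L' ⁻¹' {n})).map (fun t => τ (L' t) t) =
      leb01.restrict (L ⁻¹' {n}) := by
    intro n
    rw [← hτm n]
    refine Measure.map_congr ?_
    filter_upwards [ae_restrict_mem (hL' (measurableSet_singleton n))] with t ht
    rw [show L' t = n from ht]
  refine ⟨_, ⟨hσ, ?_⟩, ?_⟩
  · conv_lhs => rw [hsum L' hL']
    conv_rhs => rw [hsum L hL]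
    rw [Measure.map_sum hσ.aemeasurable]
    simp_rw [hpiece]
  · have hms : MeasurableSet {t | L (τ (L' t) t) = L' t} :=
      measurableSet_eq_fun (hL.comp hσ) hL'
    rw [hsum L' hL', Measure.ae_sum_iff' hms]
    intro n
    have h1 : ∀ᵐ t ∂(leb01.restrict (L ⁻¹' {n})), L t = n :=
      ae_restrict_mem (hL (measurableSet_singleton n))
    rw [← hpiece n] at h1
    filter_upwards [ae_of_ae_map hσ.aemeasurable h1,
      ae_restrict_mem (hL' (measurableSet_singleton n))] with t ht ht'
    rw [ht, show L' t = n from ht']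

/-- A function is dominated, up to a small constant, by a rearrangement (by a measure preserving
map) of any function equimeasurable with it. -/
theorem Equimeasurable.exists_le_comp {f g : L0} (h : Equimeasurable f g) {ε : ℝ} (hε : 0 < ε) :
    ∃ σ : ℝ → ℝ, MeasurePreserving σ leb01 leb01 ∧ ∀ᵐ t ∂leb01, |g t| ≤ |f (σ t)| + ε := by
  -- Rounding to multiples of `ε`: $\varepsilon L\le|f|\le\varepsilon(L+1)$. The ceiling produces
  -- strict thresholds, and truncated subtraction merges the value $0$ with $(0,\varepsilon]$, so
  -- that only the positive thresholds seen by `Equimeasurable` occur.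
  let L : L0 → ℝ → ℕ := fun f t => ⌈|f t| / ε⌉₊ - 1
  have hL : ∀ f : L0, Measurable (L f) := fun f =>
    (measurable_from_top (f := fun n : ℕ => n - 1)).comp
      (Nat.measurable_ceil.comp (f.measurable.norm.div_const ε))
  have hge : ∀ (f : L0) (n : ℕ), {t | n + 1 ≤ L f t} = {t | (n + 1 : ℝ) * ε < |f t|} := by
    intro f n
    ext t
    simp only [L, mem_ofPred_eq]
    rw [← lt_div_iff₀ hε, show (n + 1 : ℝ) = ((n + 1 : ℕ) : ℝ) by push_cast; ring, ← Nat.lt_ceil]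
    omega
  have hge' : ∀ n : ℕ, leb01 {t | n ≤ L f t} = leb01 {t | n ≤ L g t} := by
    rintro (_ | n)
    · simp
    · rw [hge, hge]
      exact h _ (by positivity)
  have hlev : ∀ n, leb01 (L g ⁻¹' {n}) = leb01 (L f ⁻¹' {n}) := by
    intro n
    have hd : ∀ f : L0, leb01 (L f ⁻¹' {n}) =
        leb01 {t | n ≤ L f t} - leb01 {t | n + 1 ≤ L f t} := by
      intro f
      have hsub : {t | n + 1 ≤ L f t} ⊆ {t | n ≤ L f t} := fun t ht => le_trans (Nat.le_succ n) ht
      rw [← measure_sdiff hsub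
        (measurableSet_le measurable_const (hL f)).nullMeasurableSet (measure_ne_top _ _)]
      congr 1
      ext t
      simp only [mem_preimage, mem_singleton_iff, Set.mem_sdiff, mem_ofPred_eq]
      omega
    rw [hd, hd, hge', hge']
  obtain ⟨σ, hσ, hσL⟩ := exists_measurePreserving_comp_eq (hL f) (hL g) hlev
  refine ⟨σ, hσ, hσL.mono fun t ht => ?_⟩
  have h1 : |g t| ≤ ε * (L g t + 1) := by
    have h2 : |g t| / ε ≤ ⌈|g t| / ε⌉₊ := Nat.le_ceil _
    have h3 : (⌈|g t| / ε⌉₊ : ℝ) ≤ L g t + 1 := by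
      have : ⌈|g t| / ε⌉₊ ≤ L g t + 1 := by simp only [L]; omega
      exact_mod_cast this
    rw [mul_comm, ← div_le_iff₀ hε]
    exact h2.trans h3
  have h4 : ε * L f (σ t) ≤ |f (σ t)| := by
    rcases Nat.eq_zero_or_pos (L f (σ t)) with h0 | h0
    · rw [h0]; simp
    · obtain ⟨k, hk⟩ := Nat.exists_eq_add_of_lt h0
      have : σ t ∈ {t | k + 1 ≤ L f t} := by simp only [mem_ofPred_eq]; omega
      rw [hge] at this
      have hk' : (L f (σ t) : ℝ) = k + 1 := by rw [hk]; push_cast; ring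
      rw [hk', mul_comm]
      exact le_of_lt this
  rw [ht] at h4
  linarith

theorem L0.abs_le_abs_iff {f g : L0} : |f| ≤ |g| ↔ ∀ᵐ t ∂leb01, |f t| ≤ |g t| := by
  rw [← AEEqFun.coeFn_le]
  constructor <;> intro h <;>
    filter_upwards [h, AEEqFun.coeFn_abs f, AEEqFun.coeFn_abs g] with t h1 h2 h3
  · rwa [h2, h3] at h1
  · rwa [h2, h3]

/-- Composition with a measure preserving map does not change the distribution. -/
theorem equimeasurable_compMeasurePreserving (f : L0) {σ : ℝ → ℝ}
    (hσ : MeasurePreserving σ leb01 leb01) :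
    Equimeasurable (f.compMeasurePreserving σ hσ) f := by
  intro τ _
  have h1 : leb01 {t | τ < |f.compMeasurePreserving σ hσ t|} = leb01 (σ ⁻¹' {t | τ < |f t|}) := by
    refine measure_congr ?_
    filter_upwards [f.coeFn_compMeasurePreserving hσ] with t ht
    show (τ < |_|) = (τ < |_|)
    rw [ht]
    rfl
  rw [h1, hσ.measure_preimage]
  exact (measurableSet_lt measurable_const f.measurable.norm).nullMeasurableSet

theorem Equimeasurable.symm {f g : L0} (h : Equimeasurable f g) : Equimeasurable g f :=
  fun τ hτ => (h τ hτ).symm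

/-! ### The lattice norm as a function on all of `L0`. -/

namespace BanachFunctionLattice

variable {X X₀ X₁ : BanachFunctionLattice}

/-- The norm of the lattice, extended by zero to all functions. -/
def normOf (X : BanachFunctionLattice) (f : L0) : ℝ :=
  open Classical in if h : f ∈ X.carrier then X.nrm ⟨f, h⟩ else 0

theorem normOf_of_mem {f : L0} (h : f ∈ X.carrier) : X.normOf f = X.nrm ⟨f, h⟩ := dif_pos h

theorem norm_mk' {f : L0} (h : f ∈ X.carrier) : ‖X.mk' f h‖ = X.normOf f :=
  (normOf_of_mem h).symm

theorem normOf_toFun (x : X.Elem) : X.normOf x.toFun = ‖x‖ := normOf_of_mem x.mem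

theorem normOf_nonneg (f : L0) : 0 ≤ X.normOf f := by
  unfold normOf
  split_ifs with h
  · exact apply_nonneg _ _
  · exact le_rfl

theorem mem_of_abs_le {f g : L0} (hg : g ∈ X.carrier) (h : ∀ᵐ t ∂leb01, |f t| ≤ |g t|) :
    f ∈ X.carrier := (X.ideal f g hg (L0.abs_le_abs_iff.2 h)).1

theorem normOf_mono {f g : L0} (hg : g ∈ X.carrier) (h : ∀ᵐ t ∂leb01, |f t| ≤ |g t|) :
    X.normOf f ≤ X.normOf g := by
  obtain ⟨hf, hle⟩ := X.ideal f g hg (L0.abs_le_abs_iff.2 h)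
  rwa [normOf_of_mem hf, normOf_of_mem hg]

theorem normOf_add_le {f g : L0} (hf : f ∈ X.carrier) (hg : g ∈ X.carrier) :
    X.normOf (f + g) ≤ X.normOf f + X.normOf g := by
  rw [normOf_of_mem hf, normOf_of_mem hg, normOf_of_mem (add_mem hf hg)]
  exact map_add_le_add X.nrm ⟨f, hf⟩ ⟨g, hg⟩

theorem normOf_smul (c : ℝ) {f : L0} (hf : f ∈ X.carrier) :
    X.normOf (c • f) = |c| * X.normOf f := by
  rw [normOf_of_mem hf, normOf_of_mem (X.carrier.smul_mem c hf)]
  exact map_smul_eq_mul X.nrm c ⟨f, hf⟩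

theorem normOf_zero : X.normOf 0 = 0 := by
  rw [normOf_of_mem (zero_mem _)]
  exact map_zero X.nrm

theorem eq_zero_of_normOf {f : L0} (hf : f ∈ X.carrier) (h : X.normOf f = 0) : f = 0 := by
  rw [normOf_of_mem hf] at h
  exact congrArg Subtype.val (X.eq_zero_of_nrm _ h)

theorem normOf_neg (f : L0) : X.normOf (-f) = X.normOf f := by
  by_cases hf : f ∈ X.carrier
  · rw [normOf_of_mem hf, normOf_of_mem (neg_mem hf)]
    exact map_neg_eq_map X.nrm ⟨f, hf⟩
  · have : -f ∉ X.carrier := fun h => hf (by simpa using neg_mem h)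
    rw [normOf, normOf, dif_neg hf, dif_neg this]

/-- Completeness in terms of functions. -/
theorem exists_limit (X : BanachFunctionLattice) {u : ℕ → L0} (hu : ∀ n, u n ∈ X.carrier)
    (hc : ∀ ε > 0, ∃ N, ∀ i ≥ N, ∀ j ≥ N, X.normOf (u i - u j) < ε) :
    ∃ f ∈ X.carrier, Tendsto (fun n => X.normOf (u n - f)) atTop (𝓝 0) := by
  obtain ⟨x, hx⟩ := X.complete (fun n => ⟨u n, hu n⟩) fun ε hε => by
    obtain ⟨N, hN⟩ := hc ε hε
    refine ⟨N, fun i hi j hj => ?_⟩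
    have := hN i hi j hj
    rwa [normOf_of_mem (sub_mem (hu i) (hu j))] at this
  refine ⟨x, x.2, hx.congr fun n => ?_⟩
  rw [normOf_of_mem (sub_mem (hu n) x.2)]
  rfl

end BanachFunctionLattice

/-! ### Riesz decomposition and the K-functional. -/

open BanachFunctionLattice

/-- Riesz decomposition. -/
theorem L0.exists_decomposition {a b c : L0} (h : ∀ᵐ t ∂leb01, |a t| ≤ |b t| + |c t|) :
    ∃ b' c' : L0, a = b' + c' ∧ (∀ᵐ t ∂leb01, |b' t| ≤ |b t|) ∧ ∀ᵐ t ∂leb01, |c' t| ≤ |c t| := by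
  -- The truncation of `a` at the levels $\pm|b|$; what is cut off has modulus at most $|c|$.
  let b' : L0 := -|b| ⊔ (|b| ⊓ a)
  have hb : ∀ᵐ t ∂leb01, b' t = max (-|b t|) (min |b t| (a t)) := by
    filter_upwards [AEEqFun.coeFn_sup (-|b|) (|b| ⊓ a), AEEqFun.coeFn_inf |b| a,
      AEEqFun.coeFn_abs b, AEEqFun.coeFn_neg |b|] with t h1 h2 h3 h4
    rw [h1, h2, h4, Pi.neg_apply, h3]
  refine ⟨b', a - b', by abel, ?_, ?_⟩
  · filter_upwards [hb] with t ht
    rw [ht, abs_le]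
    exact ⟨le_max_left _ _, max_le (by linarith [abs_nonneg (b t)]) (min_le_left _ _)⟩
  · filter_upwards [hb, h, AEEqFun.coeFn_sub a b'] with t ht h1 h2
    rw [h2, Pi.sub_apply, ht]
    have hc := abs_nonneg (c t)
    have hb0 := abs_nonneg (b t)
    obtain ⟨h3, h4⟩ := abs_le.1 h1
    rcases min_cases |b t| (a t) with ⟨e1, _⟩ | ⟨e1, _⟩ <;>
      rcases max_cases (-|b t|) (min |b t| (a t)) with ⟨e2, _⟩ | ⟨e2, _⟩ <;>
      rw [e2] <;> rw [abs_le] <;> constructor <;> linarith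

section KFunctional

variable {X₀ X₁ : BanachFunctionLattice} {α β : ℝ}

theorem kFunctional_nonneg (hα : 0 ≤ α) (hβ : 0 ≤ β) (a : L0) :
    0 ≤ kFunctional X₀ X₁ α β a := by
  refine Real.sInf_nonneg ?_
  rintro r ⟨x, y, -, rfl⟩
  positivity

theorem kFunctional_le (hα : 0 ≤ α) (hβ : 0 ≤ β) {a b c : L0} (h : a = b + c)
    (hb : b ∈ X₀.carrier) (hc : c ∈ X₁.carrier) :
    kFunctional X₀ X₁ α β a ≤ α * X₀.normOf b + β * X₁.normOf c := by
  refine csInf_le ⟨0, ?_⟩ ⟨X₀.mk' b hb, X₁.mk' c hc, h, by rw [norm_mk', norm_mk']⟩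
  rintro r ⟨x, y, -, rfl⟩
  positivity

theorem exists_of_kFunctional_lt {a : L0} (ha : a ∈ X₀.carrier ⊔ X₁.carrier) {r : ℝ}
    (hr : kFunctional X₀ X₁ α β a < r) :
    ∃ b ∈ X₀.carrier, ∃ c ∈ X₁.carrier, a = b + c ∧ α * X₀.normOf b + β * X₁.normOf c < r := by
  obtain ⟨b, hb, c, hc, h⟩ := Submodule.mem_sup.1 ha
  obtain ⟨s, ⟨x, y, h1, rfl⟩, h2⟩ := exists_lt_of_csInf_lt
    (s := {r | ∃ (a₀ : X₀.Elem) (a₁ : X₁.Elem), a = a₀.toFun + a₁.toFun ∧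
      r = α * ‖a₀‖ + β * ‖a₁‖}) ⟨_, X₀.mk' b hb, X₁.mk' c hc, h.symm, rfl⟩ hr
  exact ⟨_, x.mem, _, y.mem, h1, by rwa [normOf_toFun, normOf_toFun]⟩

/-- The common source of lattice monotonicity and of rearrangement invariance: it suffices to
transport decompositions without increasing either norm. -/
theorem kFunctional_le_kFunctional (hα : 0 ≤ α) (hβ : 0 ≤ β) {a a' : L0}
    (ha : a ∈ X₀.carrier ⊔ X₁.carrier)
    (h : ∀ b ∈ X₀.carrier, ∀ c ∈ X₁.carrier, a = b + c → ∃ b' ∈ X₀.carrier, ∃ c' ∈ X₁.carrier,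
      a' = b' + c' ∧ X₀.normOf b' ≤ X₀.normOf b ∧ X₁.normOf c' ≤ X₁.normOf c) :
    kFunctional X₀ X₁ α β a' ≤ kFunctional X₀ X₁ α β a := by
  refine le_of_forall_gt fun r hr => ?_
  obtain ⟨b, hb, c, hc, h1, h2⟩ := exists_of_kFunctional_lt ha hr
  obtain ⟨b', hb', c', hc', h3, h4, h5⟩ := h b hb c hc h1
  refine lt_of_le_of_lt (kFunctional_le hα hβ h3 hb' hc') (lt_of_le_of_lt ?_ h2)
  gcongr

theorem L0.abs_add_le (b c : L0) : ∀ᵐ t ∂leb01, |(b + c) t| ≤ |b t| + |c t| := by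
  filter_upwards [AEEqFun.coeFn_add b c] with t ht
  rw [ht]
  exact _root_.abs_add_le _ _

theorem kFunctional_mono (hα : 0 ≤ α) (hβ : 0 ≤ β) {a a' : L0}
    (ha : a ∈ X₀.carrier ⊔ X₁.carrier) (h : ∀ᵐ t ∂leb01, |a' t| ≤ |a t|) :
    kFunctional X₀ X₁ α β a' ≤ kFunctional X₀ X₁ α β a := by
  refine kFunctional_le_kFunctional hα hβ ha ?_
  rintro b hb c hc rfl
  obtain ⟨b', c', h1, h2, h3⟩ := L0.exists_decomposition (a := a') (b := b) (c := c) (by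
    filter_upwards [h, L0.abs_add_le b c] with t h1 h2 using h1.trans h2)
  exact ⟨b', mem_of_abs_le hb h2, c', mem_of_abs_le hc h3, h1, normOf_mono hb h2, normOf_mono hc h3⟩

theorem kFunctional_add_le (hα : 0 ≤ α) (hβ : 0 ≤ β) {a a' : L0}
    (ha : a ∈ X₀.carrier ⊔ X₁.carrier) (ha' : a' ∈ X₀.carrier ⊔ X₁.carrier) :
    kFunctional X₀ X₁ α β (a + a') ≤ kFunctional X₀ X₁ α β a + kFunctional X₀ X₁ α β a' := by
  refine le_of_forall_pos_le_add fun ε hε => ?_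
  obtain ⟨b, hb, c, hc, h1, h2⟩ := exists_of_kFunctional_lt ha
    (lt_add_of_pos_right (kFunctional X₀ X₁ α β a) (half_pos hε))
  obtain ⟨b', hb', c', hc', h1', h2'⟩ := exists_of_kFunctional_lt ha'
    (lt_add_of_pos_right (kFunctional X₀ X₁ α β a') (half_pos hε))
  have h3 := kFunctional_le hα hβ (show a + a' = (b + b') + (c + c') by rw [h1, h1']; abel)
    (add_mem hb hb') (add_mem hc hc')
  have h4 := mul_le_mul_of_nonneg_left (normOf_add_le hb hb') hα
  have h5 := mul_le_mul_of_nonneg_left (normOf_add_le hc hc') hβ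
  linarith

theorem kFunctional_smul_le (hα : 0 ≤ α) (hβ : 0 ≤ β) (s : ℝ) {a : L0}
    (ha : a ∈ X₀.carrier ⊔ X₁.carrier) :
    kFunctional X₀ X₁ α β (s • a) ≤ |s| * kFunctional X₀ X₁ α β a := by
  refine le_of_forall_pos_le_add fun ε hε => ?_
  have hs : 0 < |s| + 1 := by positivity
  obtain ⟨b, hb, c, hc, h1, h2⟩ := exists_of_kFunctional_lt ha
    (lt_add_of_pos_right (kFunctional X₀ X₁ α β a) (div_pos hε hs))
  have h3 := kFunctional_le hα hβ (show s • a = s • b + s • c by rw [h1, smul_add])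
    (X₀.carrier.smul_mem s hb) (X₁.carrier.smul_mem s hc)
  rw [normOf_smul s hb, normOf_smul s hc] at h3
  have h4 := mul_le_mul_of_nonneg_left h2.le (abs_nonneg s)
  have h5 : |s| * (ε / (|s| + 1)) ≤ ε := by
    rw [mul_div_assoc', div_le_iff₀ hs]
    nlinarith
  nlinarith

theorem kFunctional_smul (hα : 0 ≤ α) (hβ : 0 ≤ β) (s : ℝ) {a : L0}
    (ha : a ∈ X₀.carrier ⊔ X₁.carrier) :
    kFunctional X₀ X₁ α β (s • a) = |s| * kFunctional X₀ X₁ α β a := by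
  refine le_antisymm (kFunctional_smul_le hα hβ s ha) ?_
  rcases eq_or_ne s 0 with rfl | hs
  · simpa using kFunctional_nonneg hα hβ (0 : L0)
  · have h := kFunctional_smul_le hα hβ s⁻¹ (Submodule.smul_mem _ s ha)
    rw [inv_smul_smul₀ hs, abs_inv, inv_mul_eq_div, le_div_iff₀ (abs_pos.2 hs)] at h
    linarith

theorem kFunctional_le_mul_normOf (hα : 0 ≤ α) (hβ : 0 ≤ β) {a : L0} (ha : a ∈ X₁.carrier) :
    kFunctional X₀ X₁ α β a ≤ β * X₁.normOf a := by
  have h := kFunctional_le hα hβ (zero_add a).symm (zero_mem X₀.carrier) ha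
  rwa [normOf_zero, mul_zero, zero_add] at h

theorem kFunctional_le_mul_normOf' (hα : 0 ≤ α) (hβ : 0 ≤ β) {a : L0} (ha : a ∈ X₀.carrier) :
    kFunctional X₀ X₁ α β a ≤ α * X₀.normOf a := by
  have h := kFunctional_le hα hβ (add_zero a).symm ha (zero_mem X₁.carrier)
  rwa [normOf_zero, mul_zero, add_zero] at h

end KFunctional

theorem RISpace.mem_of_equimeasurable {X : RISpace} {f g : L0} (h : Equimeasurable f g)
    (hg : g ∈ X.carrier) : f ∈ X.carrier := (X.rearrangement f g hg h).1

theorem RISpace.normOf_eq_of_equimeasurable {X : RISpace} {f g : L0} (h : Equimeasurable f g)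
    (hg : g ∈ X.carrier) : X.normOf f = X.normOf g := by
  obtain ⟨hf, h1⟩ := X.rearrangement f g hg h
  rw [normOf_of_mem hf, normOf_of_mem hg, h1]

/-- Composing both pieces of a decomposition with `σ` keeps their distributions, hence their norms.
-/
theorem kFunctional_compMeasurePreserving {X₀ X₁ : RISpace} {α β : ℝ} (hα : 0 ≤ α) (hβ : 0 ≤ β)
    {a : L0} (ha : a ∈ X₀.carrier ⊔ X₁.carrier) {σ : ℝ → ℝ}
    (hσ : MeasurePreserving σ leb01 leb01) :
    kFunctional X₀.toBanachFunctionLattice X₁.toBanachFunctionLattice α β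
        (a.compMeasurePreserving σ hσ) ≤
      kFunctional X₀.toBanachFunctionLattice X₁.toBanachFunctionLattice α β a := by
  refine kFunctional_le_kFunctional hα hβ ha ?_
  rintro b hb c hc rfl
  have h1 := equimeasurable_compMeasurePreserving b hσ
  have h2 := equimeasurable_compMeasurePreserving c hσ
  refine ⟨_, RISpace.mem_of_equimeasurable h1 hb, _, RISpace.mem_of_equimeasurable h2 hc, ?_,
    (RISpace.normOf_eq_of_equimeasurable h1 hb).le, (RISpace.normOf_eq_of_equimeasurable h2 hc).le⟩
  induction b using AEEqFun.induction_on with | _ b hb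
  induction c using AEEqFun.induction_on with | _ c hc
  rfl

/-- The constant function one. -/
def L0.one : L0 := AEEqFun.const ℝ 1

/-- The `K`-functional depends only on the distribution. -/
theorem kFunctional_le_of_equimeasurable {X₀ X₁ : RISpace} {α β : ℝ} (hα : 0 ≤ α) (hβ : 0 ≤ β)
    {f g : L0} (hf : f ∈ X₁.carrier) (h1 : L0.one ∈ X₁.carrier) (h : Equimeasurable f g) :
    kFunctional X₀.toBanachFunctionLattice X₁.toBanachFunctionLattice α β g ≤
      kFunctional X₀.toBanachFunctionLattice X₁.toBanachFunctionLattice α β f := by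
  have hle : X₁.carrier ≤ X₀.carrier ⊔ X₁.carrier := le_sup_right
  set k := kFunctional X₀.toBanachFunctionLattice X₁.toBanachFunctionLattice α β with hk
  -- From $|g|\le|f\circ\sigma|+\varepsilon$ with `σ` measure preserving; the constant function lies
  -- in `X₁`, so the error vanishes with `ε`.
  have key : ∀ ε > 0, k g ≤ k f + ε * k L0.one := by
    intro ε hε
    obtain ⟨σ, hσ, hgs⟩ := h.exists_le_comp hε
    have hF : f.compMeasurePreserving σ hσ ∈ X₁.carrier :=
      RISpace.mem_of_equimeasurable (equimeasurable_compMeasurePreserving f hσ) hf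
    have hFa : |f.compMeasurePreserving σ hσ| ∈ X₁.carrier := by
      refine mem_of_abs_le hF ?_
      filter_upwards [AEEqFun.coeFn_abs (f.compMeasurePreserving σ hσ)] with t ht
      rw [ht, abs_abs]
    have hFa' : k |f.compMeasurePreserving σ hσ| ≤ k (f.compMeasurePreserving σ hσ) := by
      refine kFunctional_mono hα hβ (hle hF) ?_
      filter_upwards [AEEqFun.coeFn_abs (f.compMeasurePreserving σ hσ)] with t ht
      rw [ht, abs_abs]
    have h2 : k g ≤ k (|f.compMeasurePreserving σ hσ| + ε • L0.one) := by
      refine kFunctional_mono hα hβ (hle (add_mem hFa (Submodule.smul_mem _ ε h1))) ?_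
      filter_upwards [hgs, AEEqFun.coeFn_abs (f.compMeasurePreserving σ hσ),
        AEEqFun.coeFn_add |f.compMeasurePreserving σ hσ| (ε • L0.one),
        AEEqFun.coeFn_smul ε L0.one, AEEqFun.coeFn_const ℝ (μ := leb01) (1 : ℝ),
        f.coeFn_compMeasurePreserving hσ] with t e1 e2 e3 e4 e5 e6
      rw [e3, Pi.add_apply, e4, Pi.smul_apply, L0.one, e5, e2, e6]
      refine e1.trans (le_trans (le_of_eq ?_) (le_abs_self _))
      simp
    calc k g ≤ k |f.compMeasurePreserving σ hσ| + k (ε • L0.one) :=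
          h2.trans (kFunctional_add_le hα hβ (hle hFa) (hle (Submodule.smul_mem _ ε h1)))
      _ ≤ k f + ε * k L0.one := by
          refine add_le_add (hFa'.trans
            (kFunctional_compMeasurePreserving hα hβ (hle hf) hσ)) (le_of_eq ?_)
          rw [hk, kFunctional_smul hα hβ ε (hle h1), abs_of_pos hε]
  have hk1 : 0 ≤ k L0.one := kFunctional_nonneg hα hβ _
  refine le_of_forall_pos_le_add fun ε hε => (key (ε / (k L0.one + 1)) (by positivity)).trans ?_
  have : ε / (k L0.one + 1) * k L0.one ≤ ε := by
    rw [div_mul_eq_mul_div, div_le_iff₀ (by positivity)]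
    nlinarith
  linarith

/-! ### Restriction to sets; constants in an r.i. space; continuity of inclusions. -/

namespace L0

/-- The restriction of a function to a measurable set. -/
def cutoff (A : Set ℝ) (hA : MeasurableSet A) : L0 →ₗ[ℝ] L0 where
  toFun f := AEEqFun.mk (A.indicator f) (f.aestronglyMeasurable.indicator hA)
  map_add' f g := by
    refine AEEqFun.ext ?_
    filter_upwards [AEEqFun.coeFn_mk _ ((f + g).aestronglyMeasurable.indicator hA),
      AEEqFun.coeFn_mk _ (f.aestronglyMeasurable.indicator hA),
      AEEqFun.coeFn_mk _ (g.aestronglyMeasurable.indicator hA), AEEqFun.coeFn_add f g,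
      AEEqFun.coeFn_add (AEEqFun.mk _ (f.aestronglyMeasurable.indicator hA))
        (AEEqFun.mk _ (g.aestronglyMeasurable.indicator hA))] with t h1 h2 h3 h4 h5
    rw [h1, h5, Pi.add_apply, h2, h3]
    by_cases ht : t ∈ A <;> simp [ht, h4]
  map_smul' c f := by
    refine AEEqFun.ext ?_
    filter_upwards [AEEqFun.coeFn_mk _ ((c • f).aestronglyMeasurable.indicator hA),
      AEEqFun.coeFn_mk _ (f.aestronglyMeasurable.indicator hA), AEEqFun.coeFn_smul c f,
      AEEqFun.coeFn_smul c (AEEqFun.mk _ (f.aestronglyMeasurable.indicator hA))]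
      with t h1 h2 h3 h4
    rw [h1, RingHom.id_apply, h4, Pi.smul_apply, h2]
    by_cases ht : t ∈ A <;> simp [ht, h3]

variable {A B : Set ℝ} {hA : MeasurableSet A} {hB : MeasurableSet B}

theorem coeFn_cutoff (f : L0) : ∀ᵐ t ∂leb01, cutoff A hA f t = A.indicator f t :=
  AEEqFun.coeFn_mk _ (f.aestronglyMeasurable.indicator hA)

theorem abs_cutoff_le (f : L0) : ∀ᵐ t ∂leb01, |cutoff A hA f t| ≤ |f t| := by
  filter_upwards [coeFn_cutoff (hA := hA) f] with t ht
  rw [ht]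
  by_cases h : t ∈ A <;> simp [h]

theorem coeFn_one : ∀ᵐ t ∂leb01, one t = 1 := AEEqFun.coeFn_const ℝ (μ := leb01) (1 : ℝ)

theorem coeFn_cutoff_one : ∀ᵐ t ∂leb01, cutoff A hA one t = A.indicator 1 t := by
  filter_upwards [coeFn_cutoff (hA := hA) one, coeFn_one] with t h1 h2
  rw [h1]
  by_cases h : t ∈ A <;> simp [h, h2]

theorem equimeasurable_cutoff_one (h : leb01 A = leb01 B) :
    Equimeasurable (cutoff A hA one) (cutoff B hB one) := by
  intro τ hτ
  have key : ∀ (C : Set ℝ) (hC : MeasurableSet C),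
      leb01 {t | τ < |cutoff C hC one t|} = if τ < 1 then leb01 C else 0 := by
    intro C hC
    have h1 : leb01 {t | τ < |cutoff C hC one t|} =
        leb01 {t | τ < |C.indicator (1 : ℝ → ℝ) t|} := by
      refine measure_congr ?_
      filter_upwards [coeFn_cutoff_one (hA := hC)] with t ht
      show (τ < |_|) = (τ < |_|)
      rw [ht]
    rw [h1]
    split_ifs with h2
    · congr 1
      ext t
      by_cases ht : t ∈ C <;> simp [ht, h2, hτ.le]
    · convert measure_empty (μ := leb01)
      ext t
      by_cases ht : t ∈ C <;> simp [ht, not_lt.1 h2, hτ.le]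
  rw [key, key, h]

end L0

open L0

/-- The bounds on `s` keep the interval inside $[0,1]$, so its indicator is equimeasurable with that
of `A`. -/
theorem RISpace.cutoff_Icc_mem {X : RISpace} {A : Set ℝ} {hA : MeasurableSet A}
    (h : cutoff A hA one ∈ X.carrier) {s : ℝ} (hs : (leb01 A).toReal ≤ s) (hs1 : s ≤ 1) :
    cutoff (Icc (s - (leb01 A).toReal) s) measurableSet_Icc one ∈ X.carrier := by
  refine RISpace.mem_of_equimeasurable (equimeasurable_cutoff_one ?_) h
  have : Icc (s - (leb01 A).toReal) s ∩ Icc 0 1 = Icc (s - (leb01 A).toReal) s := by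
    refine inter_eq_left.2 (Icc_subset_Icc (by linarith) hs1)
  rw [Measure.restrict_apply measurableSet_Icc, this, Real.volume_Icc, sub_sub_cancel,
    ENNReal.ofReal_toReal (measure_ne_top _ _)]

/-- A nonzero r.i. space contains the bounded functions. -/
theorem RISpace.one_mem (X : RISpace) : one ∈ X.carrier := by
  obtain ⟨f, hf, hf0⟩ := Submodule.exists_mem_ne_zero_of_ne_bot X.nontrivial
  obtain ⟨n, hn⟩ : ∃ n : ℕ, leb01 {t | 1 / ((n : ℝ) + 1) < |f t|} ≠ 0 := by
    by_contra! hcon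
    refine hf0 (AEEqFun.ext ?_)
    have h1 : ∀ᵐ t ∂leb01, ∀ n : ℕ, |f t| ≤ 1 / ((n : ℝ) + 1) := by
      rw [ae_all_iff]
      intro n
      rw [ae_iff]
      simpa using hcon n
    filter_upwards [h1, AEEqFun.coeFn_zero (α := ℝ) (μ := leb01) (β := ℝ)] with t ht h0
    rw [h0, Pi.zero_apply]
    exact abs_nonpos_iff.1 (ge_of_tendsto' tendsto_one_div_add_atTop_nhds_zero_nat ht)
  set A := {t | 1 / ((n : ℝ) + 1) < |f t|} with hAdef
  have hA : MeasurableSet A := measurableSet_lt measurable_const f.measurable.norm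
  have hAX : cutoff A hA one ∈ X.carrier := by
    refine mem_of_abs_le (X.carrier.smul_mem ((n : ℝ) + 1) hf) ?_
    filter_upwards [coeFn_cutoff_one (hA := hA), AEEqFun.coeFn_smul ((n : ℝ) + 1) f] with t h1 h2
    rw [h1, h2]
    by_cases h : t ∈ A
    · have h3 : 1 / ((n : ℝ) + 1) < |f t| := h
      rw [div_lt_iff₀ (by positivity)] at h3
      simp only [h, indicator_of_mem, Pi.one_apply, abs_one, Pi.smul_apply, smul_eq_mul, abs_mul]
      rw [abs_of_pos (by positivity : (0 : ℝ) < n + 1)]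
      linarith
    · simp only [h, not_false_eq_true, indicator_of_notMem, abs_zero]
      positivity
  set a := (leb01 A).toReal with ha
  have ha0 : 0 < a := ENNReal.toReal_pos hn (measure_ne_top _ _)
  have ha1 : a ≤ 1 := by
    have : leb01 A ≤ 1 := (measure_mono (subset_univ A)).trans (by simp)
    exact ENNReal.toReal_le_of_le_ofReal zero_le_one (by simpa using this)
  -- Intervals of length `a` carry indicators in the space, and finitely many of them cover $[0,1]$;
  -- the last one is shifted back so as not to leave it.
  have key : ∀ k : ℕ, cutoff (Icc 0 (min 1 (k * a))) measurableSet_Icc one ∈ X.carrier := by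
    intro k
    induction k with
    | zero =>
      convert zero_mem X.carrier
      refine AEEqFun.ext ?_
      filter_upwards [coeFn_cutoff_one (hA := measurableSet_Icc (a := (0 : ℝ))
        (b := min 1 ((0 : ℕ) * a))), AEEqFun.coeFn_zero (α := ℝ) (μ := leb01) (β := ℝ),
        Measure.ae_ne (μ := leb01) (0 : ℝ)] with t h1 h2 h3
      rw [h1, h2]
      refine indicator_of_notMem ?_ _
      simp only [CharP.cast_eq_zero, zero_mul, mem_Icc]
      intro h
      rw [min_eq_right zero_le_one] at h
      exact h3 (le_antisymm h.2 h.1)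
    | succ k ih =>
      set s := min 1 (((k + 1 : ℕ) : ℝ) * a) with hs
      have hs1 : s ≤ 1 := min_le_left _ _
      have hs2 : a ≤ s := by
        have hka := mul_nonneg (Nat.cast_nonneg (α := ℝ) k) ha0.le
        exact le_min ha1 (by push_cast; linarith)
      have hs3 : s - a ≤ min 1 (k * a) := by
        refine le_min (by linarith) ?_
        have : s ≤ ((k + 1 : ℕ) : ℝ) * a := min_le_right _ _
        push_cast at this
        linarith
      refine mem_of_abs_le (add_mem ih (RISpace.cutoff_Icc_mem hAX hs2 hs1)) ?_
      filter_upwards [coeFn_cutoff_one (hA := measurableSet_Icc (a := (0 : ℝ)) (b := s)),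
        coeFn_cutoff_one (hA := measurableSet_Icc (a := (0 : ℝ)) (b := min 1 (k * a))),
        coeFn_cutoff_one (hA := measurableSet_Icc (a := s - a) (b := s)),
        AEEqFun.coeFn_add (cutoff (Icc 0 (min 1 (k * a))) measurableSet_Icc one)
          (cutoff (Icc (s - a) s) measurableSet_Icc one)] with t h1 h2 h3 h4
      rw [h4, Pi.add_apply, h1, h2, h3]
      have hp1 : 0 ≤ (Icc 0 (min 1 (k * a))).indicator (1 : ℝ → ℝ) t :=
        indicator_nonneg (fun _ _ => zero_le_one) _
      have hp2 : 0 ≤ (Icc (s - a) s).indicator (1 : ℝ → ℝ) t :=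
        indicator_nonneg (fun _ _ => zero_le_one) _
      have hp3 : 0 ≤ (Icc 0 s).indicator (1 : ℝ → ℝ) t :=
        indicator_nonneg (fun _ _ => zero_le_one) _
      rw [abs_of_nonneg (add_nonneg hp1 hp2), abs_of_nonneg hp3]
      by_cases ht : t ∈ Icc 0 s
      · rw [indicator_of_mem ht, Pi.one_apply]
        rcases le_total t (min 1 (k * a)) with h5 | h5
        · rw [indicator_of_mem (show t ∈ Icc 0 (min 1 (k * a)) from ⟨ht.1, h5⟩), Pi.one_apply]
          linarith
        · rw [indicator_of_mem (show t ∈ Icc (s - a) s from ⟨hs3.trans h5, ht.2⟩), Pi.one_apply]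
          linarith
      · rw [indicator_of_notMem ht]
        exact add_nonneg hp1 hp2
  obtain ⟨k, hk⟩ := exists_nat_ge (1 / a)
  have hk1 : min 1 ((k : ℝ) * a) = 1 := min_eq_left (by rwa [div_le_iff₀ ha0] at hk)
  refine mem_of_abs_le (key k) ?_
  filter_upwards [coeFn_one, coeFn_cutoff_one (hA := measurableSet_Icc (a := (0 : ℝ))
    (b := min 1 (k * a))), ae_restrict_mem measurableSet_Icc] with t h1 h2 h3
  rw [h1, h2, hk1, indicator_of_mem h3, Pi.one_apply]

/-- Inclusions of Banach function lattices are bounded. -/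
theorem BanachFunctionLattice.exists_normOf_le {X₀ X₁ : BanachFunctionLattice}
    (h : X₀.carrier ≤ X₁.carrier) :
    ∃ C > 0, ∀ f ∈ X₀.carrier, X₁.normOf f ≤ C * X₀.normOf f := by
  by_contra! hcon
  have hpow : ∀ n : ℕ, (0 : ℝ) < 4 ^ n := fun n => by positivity
  choose f hf hlt using fun n : ℕ => hcon (4 ^ n) (hpow n)
  have habs : ∀ g : L0, ∀ᵐ t ∂leb01, |(|g| : L0) t| ≤ |g t| ∧ |g t| ≤ |(|g| : L0) t| := by
    intro g
    filter_upwards [AEEqFun.coeFn_abs g] with t ht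
    rw [ht, abs_abs]
    exact ⟨le_rfl, le_rfl⟩
  have habs0 : ∀ n, |f n| ∈ X₀.carrier := fun n =>
    mem_of_abs_le (hf n) ((habs (f n)).mono fun t ht => ht.1)
  have habsn : ∀ n, X₀.normOf |f n| ≤ X₀.normOf (f n) := fun n =>
    normOf_mono (hf n) ((habs (f n)).mono fun t ht => ht.1)
  have habsn' : ∀ n, X₁.normOf (f n) ≤ X₁.normOf |f n| := fun n =>
    normOf_mono (h (habs0 n)) ((habs (f n)).mono fun t ht => ht.2)
  have hpos : ∀ n, 0 < X₀.normOf (f n) := by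
    intro n
    refine lt_of_le_of_ne (normOf_nonneg _) fun h0 => ?_
    have h1 := eq_zero_of_normOf (hf n) h0.symm
    have h2 := hlt n
    rw [h1, normOf_zero, normOf_zero, mul_zero] at h2
    exact lt_irrefl _ h2
  -- Of the factor $4^n=2^n2^n$, one half pays for convergence of $\sum g_n$ in `X₀` and the other
  -- leaves $\|g_n\|_{X_1}\ge 2^n$. The sum dominates every $g_n$, which is absurd in `X₁`.
  let g : ℕ → L0 := fun n => ((1 / 2) ^ n * (X₀.normOf (f n))⁻¹) • |f n|
  have hcoef : ∀ n, 0 < (1 / 2 : ℝ) ^ n * (X₀.normOf (f n))⁻¹ := fun n => by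
    have := hpos n
    positivity
  have hg0 : ∀ n, g n ∈ X₀.carrier := fun n => X₀.carrier.smul_mem _ (habs0 n)
  have hgn : ∀ n, X₀.normOf (g n) ≤ (1 / 2) ^ n := by
    intro n
    rw [normOf_smul _ (habs0 n), abs_of_pos (hcoef n)]
    calc _ ≤ (1 / 2 : ℝ) ^ n * (X₀.normOf (f n))⁻¹ * X₀.normOf (f n) := by
          have := (hcoef n).le
          gcongr
          exact habsn n
      _ = _ := by rw [mul_assoc, inv_mul_cancel₀ (hpos n).ne', mul_one]
  have hg1 : ∀ n, 2 ^ n ≤ X₁.normOf (g n) := by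
    intro n
    rw [normOf_smul _ (h (habs0 n)), abs_of_pos (hcoef n)]
    calc (2 : ℝ) ^ n = (1 / 2 : ℝ) ^ n * (X₀.normOf (f n))⁻¹ * (4 ^ n * X₀.normOf (f n)) := by
          have : (4 : ℝ) ^ n = 2 ^ n * 2 ^ n := by rw [← mul_pow]; norm_num
          have h3 := (hpos n).ne'
          rw [this]
          field_simp
          rw [← mul_pow]
          norm_num
      _ ≤ _ := by
          have := (hcoef n).le
          gcongr
          exact (hlt n).le.trans (habsn' n)
  have hgpos : ∀ n, 0 ≤ g n := by
    intro n
    rw [← AEEqFun.coeFn_le]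
    filter_upwards [AEEqFun.coeFn_smul ((1 / 2) ^ n * (X₀.normOf (f n))⁻¹) |f n|,
      AEEqFun.coeFn_abs (f n), AEEqFun.coeFn_zero (α := ℝ) (μ := leb01) (β := ℝ)] with t h1 h2 h3
    rw [h1, h3, Pi.smul_apply, h2, Pi.zero_apply, smul_eq_mul]
    exact mul_nonneg (hcoef n).le (abs_nonneg _)
  let u : ℕ → L0 := fun n => ∑ i ∈ Finset.range n, g i
  have hu : ∀ n, u n ∈ X₀.carrier := fun n => sum_mem fun i _ => hg0 i
  have hsum : ∀ s : Finset ℕ, X₀.normOf (∑ i ∈ s, g i) ≤ ∑ i ∈ s, (1 / 2 : ℝ) ^ i := by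
    intro s
    induction s using Finset.induction_on with
    | empty => simp [normOf_zero]
    | insert i s his ih =>
      rw [Finset.sum_insert his, Finset.sum_insert his]
      exact (normOf_add_le (hg0 i) (sum_mem fun i _ => hg0 i)).trans (add_le_add (hgn i) ih)
  have hgeom : ∀ i j : ℕ, i ≤ j → X₀.normOf (u j - u i) ≤ 2 * (1 / 2) ^ i := by
    intro i j hij
    have h1 : u j - u i = ∑ k ∈ Finset.Ico i j, g k := (Finset.sum_Ico_eq_sub g hij).symm
    rw [h1]
    refine (hsum _).trans ?_
    rw [geom_sum_Ico (by norm_num) hij]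
    have : (0 : ℝ) < (1 / 2) ^ j := by positivity
    rw [div_le_iff_of_neg (by norm_num)]
    linarith
  obtain ⟨x, hx, hlim⟩ := X₀.exists_limit hu fun ε hε => by
    obtain ⟨N, hN⟩ := exists_pow_lt_of_lt_one (half_pos hε) (show (1 / 2 : ℝ) < 1 by norm_num)
    refine ⟨N, ?_⟩
    have hmain : ∀ i ≥ N, ∀ j ≥ i, X₀.normOf (u j - u i) < ε := by
      intro i hi j hij
      have h1 := hgeom i j hij
      have h2 : (1 / 2 : ℝ) ^ i ≤ (1 / 2) ^ N :=
        pow_le_pow_of_le_one (by norm_num) (by norm_num) hi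
      linarith
    intro i hi j hj
    rcases le_total i j with hij | hij
    · rw [← normOf_neg, neg_sub]
      exact hmain i hi j hij
    · exact hmain j hj i hij
  have hmono : ∀ i j : ℕ, i ≤ j → ∀ᵐ t ∂leb01, 0 ≤ u i t ∧ u i t ≤ u j t := by
    intro i j hij
    have hg' : ∀ᵐ t ∂leb01, ∀ k, 0 ≤ g k t := by
      rw [ae_all_iff]
      intro k
      filter_upwards [AEEqFun.coeFn_le.2 (hgpos k),
        AEEqFun.coeFn_zero (α := ℝ) (μ := leb01) (β := ℝ)] with t h1 h2
      rwa [h2] at h1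
    filter_upwards [hg', AEEqFun.coeFn_fun_finsetSum (Finset.range i) g,
      AEEqFun.coeFn_fun_finsetSum (Finset.range j) g] with t h1 h2 h3
    have e2 : u i t = ∑ k ∈ Finset.range i, g k t := h2
    have e3 : u j t = ∑ k ∈ Finset.range j, g k t := h3
    rw [e2, e3]
    exact ⟨Finset.sum_nonneg fun k _ => h1 k, Finset.sum_le_sum_of_subset_of_nonneg
      (Finset.range_mono hij) fun k _ _ => h1 k⟩
  -- Only norm convergence is available: $(u_n-x)^+\le|u_j-x|$ for $j\ge n$, so $(u_n-x)^+$ has norm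
  -- zero.
  have hle : ∀ n, ∀ᵐ t ∂leb01, u n t ≤ x t := by
    intro n
    have h0 : ((u n - x) ⊔ 0 : L0) = 0 := by
      have hpt : ∀ᵐ t ∂leb01, ((u n - x) ⊔ 0 : L0) t = max (u n t - x t) 0 := by
        filter_upwards [AEEqFun.coeFn_sup (u n - x) 0, AEEqFun.coeFn_sub (u n) x,
          AEEqFun.coeFn_zero (α := ℝ) (μ := leb01) (β := ℝ)] with t h1 h2 h3
        rw [h1, h2, h3]
        rfl
      have hcmp : ∀ j ≥ n, ∀ᵐ t ∂leb01, |((u n - x) ⊔ 0 : L0) t| ≤ |(u j - x) t| := by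
        intro j hj
        filter_upwards [hpt, hmono n j hj, AEEqFun.coeFn_sub (u j) x] with t h1 h2 h3
        rw [h1, h3, Pi.sub_apply, abs_of_nonneg (le_max_right _ _)]
        exact max_le ((sub_le_sub_right h2.2 _).trans (le_abs_self _)) (abs_nonneg _)
      refine eq_zero_of_normOf (mem_of_abs_le (sub_mem (hu n) hx) (hcmp n le_rfl)) ?_
      refine le_antisymm (ge_of_tendsto hlim ?_) (normOf_nonneg _)
      filter_upwards [eventually_ge_atTop n] with j hj
      exact normOf_mono (sub_mem (hu j) hx) (hcmp j hj)
    have h1 : (u n - x : L0) ≤ 0 := sup_eq_right.1 h0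
    filter_upwards [AEEqFun.coeFn_le.2 h1, AEEqFun.coeFn_sub (u n) x,
      AEEqFun.coeFn_zero (α := ℝ) (μ := leb01) (β := ℝ)] with t h1 h2 h3
    rw [h2, h3, Pi.sub_apply, Pi.zero_apply] at h1
    linarith
  obtain ⟨n, hn⟩ := pow_unbounded_of_one_lt (X₁.normOf x) (show (1 : ℝ) < 2 by norm_num)
  refine absurd ((hg1 n).trans (normOf_mono (h hx) ?_)) (not_le.2 hn)
  filter_upwards [hle (n + 1), hmono n (n + 1) n.le_succ, AEEqFun.coeFn_le.2 (hgpos n),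
    AEEqFun.coeFn_zero (α := ℝ) (μ := leb01) (β := ℝ), AEEqFun.coeFn_add (u n) (g n)]
    with t h1 h2 h3 h4 h5
  rw [h4, Pi.zero_apply] at h3
  have h6 : u (n + 1) = u n + g n := Finset.sum_range_succ g n
  rw [h6, h5, Pi.add_apply] at h1
  rw [abs_of_nonneg h3]
  exact le_trans (by linarith [h2.1]) (le_abs_self _)

/-! ### Perfectly homogeneous bases and partial norms. -/

variable {E : Type*} [NormedAddCommGroup E] [NormedSpace ℝ E]

/-- A normalized `1`-unconditional sequence which is isometrically equivalent to all its normalized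
block sequences, such as the unit vector basis of `ℓ_p` or of `c₀`. -/
structure PerfectlyHomogeneous (e : ℕ → E) : Prop where
  norm_eq_one : ∀ n, ‖e n‖ = 1
  mono : ∀ (s : Finset ℕ) (a b : ℕ → ℝ), (∀ n ∈ s, |a n| ≤ |b n|) →
    ‖∑ n ∈ s, a n • e n‖ ≤ ‖∑ n ∈ s, b n • e n‖
  block : ∀ I : ℕ → Finset ℕ, Pairwise (Function.onFun Disjoint I) →
    ∀ (s : Finset ℕ) (a : ℕ → ℝ),
      ‖∑ j ∈ s, ∑ n ∈ I j, a n • e n‖ = ‖∑ j ∈ s, ‖∑ n ∈ I j, a n • e n‖ • e j‖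

namespace PerfectlyHomogeneous

variable {e : ℕ → E}

theorem mono_set (he : PerfectlyHomogeneous e) {s t : Finset ℕ} (hst : s ⊆ t) (a : ℕ → ℝ) :
    ‖∑ n ∈ s, a n • e n‖ ≤ ‖∑ n ∈ t, a n • e n‖ := by
  classical
  have h : ∑ n ∈ s, a n • e n = ∑ n ∈ t, (if n ∈ s then a n else 0) • e n := by
    rw [← Finset.sum_subset hst (fun n _ hn => by rw [if_neg hn, zero_smul])]
    exact Finset.sum_congr rfl fun n hn => by rw [if_pos hn]
  rw [h]
  refine he.mono t _ _ fun n _ => ?_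
  split_ifs <;> simp

theorem abs_le (he : PerfectlyHomogeneous e) {s : Finset ℕ} {n : ℕ} (hn : n ∈ s) (a : ℕ → ℝ) :
    |a n| ≤ ‖∑ n ∈ s, a n • e n‖ := by
  have h := he.mono_set (Finset.singleton_subset_iff.2 hn) a
  rwa [Finset.sum_singleton, norm_smul, he.norm_eq_one, mul_one, Real.norm_eq_abs] at h

/-- The coefficients may vary with the block: disjointness lets them be glued into a single
sequence. -/
theorem norm_sum_block (he : PerfectlyHomogeneous e) {I : ℕ → Finset ℕ}
    (hI : Pairwise (Function.onFun Disjoint I)) (s : Finset ℕ) (u : ℕ → ℕ → ℝ) :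
    ‖∑ j ∈ s, ∑ n ∈ I j, u j n • e n‖ = ‖∑ j ∈ s, ‖∑ n ∈ I j, u j n • e n‖ • e j‖ := by
  classical
  let a : ℕ → ℝ := fun n => ∑ i ∈ s, if n ∈ I i then u i n else 0
  have ha : ∀ j ∈ s, ∑ n ∈ I j, u j n • e n = ∑ n ∈ I j, a n • e n := by
    intro j hj
    refine Finset.sum_congr rfl fun n hn => ?_
    congr 1
    rw [show a n = ∑ i ∈ s, if n ∈ I i then u i n else 0 from rfl, Finset.sum_eq_single_of_mem j hj,
      if_pos hn]
    intro i _ hij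
    rw [if_neg]
    exact fun hni => Finset.disjoint_left.1 (hI hij) hni hn
  rw [Finset.sum_congr rfl ha, he.block I hI s a]
  congr 1
  exact Finset.sum_congr rfl fun j hj => by rw [ha j hj]

end PerfectlyHomogeneous

theorem AdmissibleWeights.pos {m : ℕ → ℝ} (hm : AdmissibleWeights m) (n : ℕ) : 0 < m n :=
  lt_of_lt_of_le (by linarith [hm.two_le]) (hm.strictMono.monotone (Nat.zero_le n))

/-- The norm of the part of `∑ k(mₙ⁻¹, mₙ, a) eₙ` over a finite set of indices. -/
def partialNorm (e : ℕ → E) (X₀ X₁ : RISpace) (m : ℕ → ℝ) (s : Finset ℕ) (a : L0) : ℝ :=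
  ‖∑ n ∈ s, kFunctional X₀.toBanachFunctionLattice X₁.toBanachFunctionLattice (m n)⁻¹ (m n) a • e n‖

section LionsPeetreSpace

variable {e : ℕ → E} {X₀ X₁ : RISpace} {m : ℕ → ℝ}

/-- Abbreviation for the weighted `K`-functional. -/
abbrev weightedK (X₀ X₁ : RISpace) (m : ℕ → ℝ) (n : ℕ) (a : L0) : ℝ :=
  kFunctional X₀.toBanachFunctionLattice X₁.toBanachFunctionLattice (m n)⁻¹ (m n) a

theorem weightedK_nonneg (hm : AdmissibleWeights m) (n : ℕ) (a : L0) : 0 ≤ weightedK X₀ X₁ m n a :=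
  kFunctional_nonneg (inv_nonneg.2 (hm.pos n).le) (hm.pos n).le a

theorem partialNorm_mono_set (he : PerfectlyHomogeneous e) {s t : Finset ℕ} (h : s ⊆ t) (a : L0) :
    partialNorm e X₀ X₁ m s a ≤ partialNorm e X₀ X₁ m t a :=
  he.mono_set h fun n => weightedK X₀ X₁ m n a

theorem partialNorm_mono (he : PerfectlyHomogeneous e) (hm : AdmissibleWeights m) (s : Finset ℕ)
    {a b : L0} (hb : b ∈ X₁.carrier) (h : ∀ᵐ t ∂leb01, |a t| ≤ |b t|) :
    partialNorm e X₀ X₁ m s a ≤ partialNorm e X₀ X₁ m s b := by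
  refine he.mono s _ _ fun n _ => ?_
  rw [abs_of_nonneg (weightedK_nonneg hm n a), abs_of_nonneg (weightedK_nonneg hm n b)]
  exact kFunctional_mono (inv_nonneg.2 (hm.pos n).le) (hm.pos n).le
    (le_sup_right (α := Submodule ℝ L0) hb) h

theorem weightedK_add_le (hm : AdmissibleWeights m) (n : ℕ) {a b : L0} (ha : a ∈ X₁.carrier)
    (hb : b ∈ X₁.carrier) :
    weightedK X₀ X₁ m n (a + b) ≤ weightedK X₀ X₁ m n a + weightedK X₀ X₁ m n b :=
  kFunctional_add_le (inv_nonneg.2 (hm.pos n).le) (hm.pos n).le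
    (le_sup_right (α := Submodule ℝ L0) ha) (le_sup_right (α := Submodule ℝ L0) hb)

theorem weightedK_smul (hm : AdmissibleWeights m) (n : ℕ) (c : ℝ) {a : L0} (ha : a ∈ X₁.carrier) :
    weightedK X₀ X₁ m n (c • a) = |c| * weightedK X₀ X₁ m n a :=
  kFunctional_smul (inv_nonneg.2 (hm.pos n).le) (hm.pos n).le c
    (le_sup_right (α := Submodule ℝ L0) ha)

theorem weightedK_le_mul_normOf (hm : AdmissibleWeights m) (n : ℕ) {a : L0} (ha : a ∈ X₁.carrier) :
    weightedK X₀ X₁ m n a ≤ m n * X₁.normOf a :=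
  kFunctional_le_mul_normOf (inv_nonneg.2 (hm.pos n).le) (hm.pos n).le ha

theorem partialNorm_add_le (he : PerfectlyHomogeneous e) (hm : AdmissibleWeights m) (s : Finset ℕ)
    {a b : L0} (ha : a ∈ X₁.carrier) (hb : b ∈ X₁.carrier) :
    partialNorm e X₀ X₁ m s (a + b) ≤ partialNorm e X₀ X₁ m s a + partialNorm e X₀ X₁ m s b := by
  refine (he.mono s _ (fun n => weightedK X₀ X₁ m n a + weightedK X₀ X₁ m n b)
    fun n _ => ?_).trans ?_
  · rw [abs_of_nonneg (weightedK_nonneg hm n _)]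
    exact (weightedK_add_le hm n ha hb).trans (le_abs_self _)
  · simp_rw [add_smul, Finset.sum_add_distrib]
    exact norm_add_le _ _

theorem partialNorm_smul (hm : AdmissibleWeights m) (s : Finset ℕ) (c : ℝ)
    {a : L0} (ha : a ∈ X₁.carrier) :
    partialNorm e X₀ X₁ m s (c • a) = |c| * partialNorm e X₀ X₁ m s a := by
  have : ∀ n, weightedK X₀ X₁ m n (c • a) • e n = |c| • (weightedK X₀ X₁ m n a • e n) := fun n => by
    rw [weightedK_smul hm n c ha, mul_smul]
  unfold partialNorm
  simp_rw [this]
  rw [← Finset.smul_sum, norm_smul, Real.norm_eq_abs, abs_abs]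

theorem weightedK_le_partialNorm (he : PerfectlyHomogeneous e) {s : Finset ℕ} {n : ℕ} (hn : n ∈ s)
    (a : L0) : weightedK X₀ X₁ m n a ≤ partialNorm e X₀ X₁ m s a :=
  (le_abs_self _).trans (he.abs_le hn fun n => weightedK X₀ X₁ m n a)

theorem partialNorm_le_sum (he : PerfectlyHomogeneous e) (hm : AdmissibleWeights m) (s : Finset ℕ)
    (a : L0) : partialNorm e X₀ X₁ m s a ≤ ∑ n ∈ s, weightedK X₀ X₁ m n a := by
  refine (norm_sum_le _ _).trans (Finset.sum_le_sum fun n _ => ?_)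
  rw [norm_smul, he.norm_eq_one, mul_one, Real.norm_eq_abs, abs_of_nonneg (weightedK_nonneg hm n a)]

theorem partialNorm_nonneg (s : Finset ℕ) (a : L0) : 0 ≤ partialNorm e X₀ X₁ m s a :=
  norm_nonneg _

theorem partialNorm_le_inter_add_sdiff (s t : Finset ℕ) (a : L0) :
    partialNorm e X₀ X₁ m s a ≤
      partialNorm e X₀ X₁ m (s ∩ t) a + partialNorm e X₀ X₁ m (s \ t) a := by
  unfold partialNorm
  rw [← Finset.sum_inter_add_sum_sdiff s t]
  exact norm_add_le _ _

/-- One coordinate already controls the norm of `X₁`, because `X₀` embeds boundedly: in the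
constant, $Cm_0$ absorbs the `X₀` part and $m_0^{-1}$ the `X₁` part. -/
theorem exists_normOf_le_weightedK (hX : X₀.carrier ≤ X₁.carrier) (hm : AdmissibleWeights m) :
    ∃ C > 0, ∀ a ∈ X₁.carrier, X₁.normOf a ≤ C * weightedK X₀ X₁ m 0 a := by
  obtain ⟨C, hC, h⟩ := exists_normOf_le hX
  have hm0 := hm.pos 0
  refine ⟨C * m 0 + (m 0)⁻¹, by positivity, fun a ha => ?_⟩
  rw [← div_le_iff₀' (by positivity)]
  refine le_of_forall_gt fun r hr => ?_
  obtain ⟨b, hb, c, hc, rfl, h2⟩ :=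
    exists_of_kFunctional_lt (le_sup_right (α := Submodule ℝ L0) ha) hr
  rw [div_lt_iff₀' (by positivity)]
  have h3 := normOf_add_le (hX hb) hc
  have h4 := h b hb
  have hb0 : 0 ≤ X₀.normOf b := normOf_nonneg b
  have hc0 : 0 ≤ X₁.normOf c := normOf_nonneg c
  have h5 : C * X₀.normOf b + X₁.normOf c ≤
      (C * m 0 + (m 0)⁻¹) * ((m 0)⁻¹ * X₀.normOf b + m 0 * X₁.normOf c) := by
    have e1 : (C * m 0 + (m 0)⁻¹) * ((m 0)⁻¹ * X₀.normOf b + m 0 * X₁.normOf c) =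
        C * X₀.normOf b + X₁.normOf c +
          (C * m 0 * m 0 * X₁.normOf c + (m 0)⁻¹ * (m 0)⁻¹ * X₀.normOf b) := by
      field_simp
      ring
    rw [e1]
    have : 0 ≤ C * m 0 * m 0 * X₁.normOf c + (m 0)⁻¹ * (m 0)⁻¹ * X₀.normOf b := by positivity
    linarith
  have h6 := mul_lt_mul_of_pos_left h2 (show 0 < C * m 0 + (m 0)⁻¹ by positivity)
  linarith

/-- The norm of the Lions-Peetre space. -/
abbrev wNorm (e : ℕ → E) (X₀ X₁ : RISpace) (m : ℕ → ℝ) (a : L0) : ℝ :=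
  lionsPeetreNorm e X₀.toBanachFunctionLattice X₁.toBanachFunctionLattice (fun n => (m n)⁻¹) m a

/-- The set of elements of the Lions-Peetre space. -/
abbrev wSet (e : ℕ → E) (X₀ X₁ : RISpace) (m : ℕ → ℝ) : Set L0 :=
  lionsPeetreSet e X₀.toBanachFunctionLattice X₁.toBanachFunctionLattice (fun n => (m n)⁻¹) m

/-- Together with `wNorm_le` this identifies the norm with the supremum of the partial norms, so
later estimates are made on finite index sets. -/
theorem partialNorm_le_wNorm (he : PerfectlyHomogeneous e) {a : L0} (ha : a ∈ wSet e X₀ X₁ m)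
    (s : Finset ℕ) : partialNorm e X₀ X₁ m s a ≤ wNorm e X₀ X₁ m a := by
  refine ge_of_tendsto (ha.2.hasSum.norm) ?_
  filter_upwards [eventually_ge_atTop s] with t ht
  exact partialNorm_mono_set he ht a

theorem wNorm_le {a : L0} (ha : a ∈ wSet e X₀ X₁ m) {r : ℝ}
    (h : ∀ s, partialNorm e X₀ X₁ m s a ≤ r) : wNorm e X₀ X₁ m a ≤ r :=
  le_of_tendsto' (ha.2.hasSum.norm) h

theorem mem_of_mem_wSet (hX : X₀.carrier ≤ X₁.carrier) {a : L0} (ha : a ∈ wSet e X₀ X₁ m) :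
    a ∈ X₁.carrier := by
  have h := ha.1
  rwa [sup_eq_right.2 hX] at h

theorem wNorm_smul (hX : X₀.carrier ≤ X₁.carrier)
    (hm : AdmissibleWeights m) (c : ℝ) {a : L0} (ha : a ∈ wSet e X₀ X₁ m) :
    wNorm e X₀ X₁ m (c • a) = |c| * wNorm e X₀ X₁ m a := by
  have : ∀ n, weightedK X₀ X₁ m n (c • a) • e n = |c| • (weightedK X₀ X₁ m n a • e n) := fun n => by
    rw [weightedK_smul hm n c (mem_of_mem_wSet hX ha), mul_smul]
  unfold wNorm lionsPeetreNorm
  simp_rw [this]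
  rw [tsum_const_smul'', norm_smul, Real.norm_eq_abs, abs_abs]

theorem exists_normOf_le_wNorm (he : PerfectlyHomogeneous e) (hX : X₀.carrier ≤ X₁.carrier)
    (hm : AdmissibleWeights m) :
    ∃ C > 0, ∀ a ∈ wSet e X₀ X₁ m, X₁.normOf a ≤ C * wNorm e X₀ X₁ m a := by
  obtain ⟨C, hC, h⟩ := exists_normOf_le_weightedK hX hm
  refine ⟨C, hC, fun a ha => (h a (mem_of_mem_wSet hX ha)).trans ?_⟩
  gcongr
  exact (weightedK_le_partialNorm he (Finset.mem_singleton_self 0) a).trans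
    (partialNorm_le_wNorm he ha _)

/-! ### The Lions-Peetre space is a Banach function lattice. -/

variable [CompleteSpace E]

theorem exists_partialNorm_lt {a : L0} (ha : a ∈ wSet e X₀ X₁ m) {ε : ℝ} (hε : 0 < ε) :
    ∃ s : Finset ℕ, ∀ t, Disjoint t s → partialNorm e X₀ X₁ m t a < ε :=
  summable_iff_vanishing_norm.1 ha.2 ε hε

/-- Cauchy criterion for unconditional convergence in the complete space `E`; here $X_0+X_1=X_1$. -/
theorem mem_wSet_iff (hX : X₀.carrier ≤ X₁.carrier) {a : L0} :
    a ∈ wSet e X₀ X₁ m ↔ a ∈ X₁.carrier ∧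
      ∀ ε > 0, ∃ s : Finset ℕ, ∀ t, Disjoint t s → partialNorm e X₀ X₁ m t a < ε := by
  refine ⟨fun h => ⟨mem_of_mem_wSet hX h, fun ε hε => exists_partialNorm_lt h hε⟩,
    fun h => ⟨?_, ?_⟩⟩
  · exact le_sup_right (α := Submodule ℝ L0) h.1
  · exact summable_iff_vanishing_norm.2 h.2

theorem wSet_of_abs_le (he : PerfectlyHomogeneous e) (hX : X₀.carrier ≤ X₁.carrier)
    (hm : AdmissibleWeights m) {a b : L0} (hb : b ∈ wSet e X₀ X₁ m)
    (h : ∀ᵐ t ∂leb01, |a t| ≤ |b t|) : a ∈ wSet e X₀ X₁ m := by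
  rw [mem_wSet_iff hX] at hb ⊢
  refine ⟨mem_of_abs_le hb.1 h, fun ε hε => ?_⟩
  obtain ⟨s, hs⟩ := hb.2 ε hε
  exact ⟨s, fun t ht => (partialNorm_mono he hm t hb.1 h).trans_lt (hs t ht)⟩

theorem wNorm_mono (he : PerfectlyHomogeneous e) (hX : X₀.carrier ≤ X₁.carrier)
    (hm : AdmissibleWeights m) {a b : L0} (hb : b ∈ wSet e X₀ X₁ m)
    (h : ∀ᵐ t ∂leb01, |a t| ≤ |b t|) : wNorm e X₀ X₁ m a ≤ wNorm e X₀ X₁ m b :=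
  wNorm_le (wSet_of_abs_le he hX hm hb h) fun s =>
    (partialNorm_mono he hm s (mem_of_mem_wSet hX hb) h).trans (partialNorm_le_wNorm he hb s)

theorem wSet_add (he : PerfectlyHomogeneous e) (hX : X₀.carrier ≤ X₁.carrier)
    (hm : AdmissibleWeights m) {a b : L0} (ha : a ∈ wSet e X₀ X₁ m) (hb : b ∈ wSet e X₀ X₁ m) :
    a + b ∈ wSet e X₀ X₁ m := by
  classical
  rw [mem_wSet_iff hX] at ha hb ⊢
  refine ⟨add_mem ha.1 hb.1, fun ε hε => ?_⟩
  obtain ⟨s, hs⟩ := ha.2 (ε / 2) (half_pos hε)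
  obtain ⟨s', hs'⟩ := hb.2 (ε / 2) (half_pos hε)
  refine ⟨s ∪ s', fun t ht => ?_⟩
  have h1 := hs t (ht.mono_right Finset.subset_union_left)
  have h2 := hs' t (ht.mono_right Finset.subset_union_right)
  have h3 := partialNorm_add_le (e := e) (X₀ := X₀) he hm t ha.1 hb.1
  linarith

theorem wSet_smul (hX : X₀.carrier ≤ X₁.carrier)
    (hm : AdmissibleWeights m) (c : ℝ) {a : L0} (ha : a ∈ wSet e X₀ X₁ m) :
    c • a ∈ wSet e X₀ X₁ m := by
  rw [mem_wSet_iff hX] at ha ⊢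
  refine ⟨X₁.carrier.smul_mem c ha.1, fun ε hε => ?_⟩
  obtain ⟨s, hs⟩ := ha.2 (ε / (|c| + 1)) (by positivity)
  refine ⟨s, fun t ht => ?_⟩
  rw [partialNorm_smul hm t c ha.1]
  have h1 := hs t ht
  rw [lt_div_iff₀ (by positivity)] at h1
  have h2 : 0 ≤ partialNorm e X₀ X₁ m t a := partialNorm_nonneg t a
  linarith

theorem wSet_zero (hX : X₀.carrier ≤ X₁.carrier)
    (hm : AdmissibleWeights m) : (0 : L0) ∈ wSet e X₀ X₁ m := by
  rw [mem_wSet_iff hX]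
  refine ⟨zero_mem _, fun ε hε => ⟨∅, fun t _ => ?_⟩⟩
  have := partialNorm_smul (e := e) (X₀ := X₀) hm t 0 (zero_mem X₁.carrier)
  rw [zero_smul, abs_zero, zero_mul] at this
  rwa [this]

theorem wNorm_add_le (he : PerfectlyHomogeneous e) (hX : X₀.carrier ≤ X₁.carrier)
    (hm : AdmissibleWeights m) {a b : L0} (ha : a ∈ wSet e X₀ X₁ m) (hb : b ∈ wSet e X₀ X₁ m) :
    wNorm e X₀ X₁ m (a + b) ≤ wNorm e X₀ X₁ m a + wNorm e X₀ X₁ m b :=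
  wNorm_le (wSet_add he hX hm ha hb) fun s =>
    (partialNorm_add_le he hm s (mem_of_mem_wSet hX ha) (mem_of_mem_wSet hX hb)).trans
      (add_le_add (partialNorm_le_wNorm he ha s) (partialNorm_le_wNorm he hb s))

/-- The coordinates are at most $m_n^{-1}\|a\|_{X_0}$, which is summable. This puts the constants
into $W$. -/
theorem mem_wSet_of_mem (he : PerfectlyHomogeneous e) (hm : AdmissibleWeights m) {a : L0}
    (ha : a ∈ X₀.carrier) : a ∈ wSet e X₀ X₁ m := by
  refine ⟨le_sup_left (α := Submodule ℝ L0) ha, Summable.of_norm_bounded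
    (hm.summable.mul_right (X₀.normOf a)) fun n => ?_⟩
  rw [norm_smul, he.norm_eq_one, mul_one, Real.norm_eq_abs, abs_of_nonneg (weightedK_nonneg hm n a)]
  exact kFunctional_le_mul_normOf' (inv_nonneg.2 (hm.pos n).le) (hm.pos n).le ha

theorem wSet_complete (he : PerfectlyHomogeneous e) (hX : X₀.carrier ≤ X₁.carrier)
    (hm : AdmissibleWeights m) {u : ℕ → L0} (hu : ∀ n, u n ∈ wSet e X₀ X₁ m)
    (hc : ∀ ε > 0, ∃ N, ∀ i ≥ N, ∀ j ≥ N, wNorm e X₀ X₁ m (u i - u j) < ε) :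
    ∃ x ∈ wSet e X₀ X₁ m, Tendsto (fun n => wNorm e X₀ X₁ m (u n - x)) atTop (𝓝 0) := by
  classical
  have hsub : ∀ {a b : L0}, a ∈ wSet e X₀ X₁ m → b ∈ wSet e X₀ X₁ m → a - b ∈ wSet e X₀ X₁ m := by
    intro a b ha hb
    have := wSet_add he hX hm ha (wSet_smul hX hm (-1) hb)
    rwa [neg_one_smul, ← sub_eq_add_neg] at this
  have hu1 : ∀ n, u n ∈ X₁.carrier := fun n => mem_of_mem_wSet hX (hu n)
  obtain ⟨C, hC, hCle⟩ := exists_normOf_le_wNorm (X₀ := X₀) (X₁ := X₁) he hX hm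
  obtain ⟨x, hx, hlim⟩ := X₁.exists_limit hu1 fun ε hε => by
    obtain ⟨N, hN⟩ := hc (ε / C) (div_pos hε hC)
    refine ⟨N, fun i hi j hj => (hCle _ (hsub (hu i) (hu j))).trans_lt ?_⟩
    have := hN i hi j hj
    rwa [lt_div_iff₀' hC] at this
  have hpart : ∀ s, Tendsto (fun n => partialNorm e X₀ X₁ m s (u n - x)) atTop (𝓝 0) := by
    intro s
    refine squeeze_zero (fun n => partialNorm_nonneg s _) (fun n => partialNorm_le_sum he hm s _) ?_
    rw [← Finset.sum_const_zero (s := s) (M := ℝ)]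
    refine tendsto_finsetSum s fun k _ => ?_
    refine squeeze_zero (fun n => weightedK_nonneg hm k _)
      (fun n => weightedK_le_mul_normOf hm k (sub_mem (hu1 n) hx)) ?_
    simpa using hlim.const_mul (m k)
  -- A Fatou argument: with `s` fixed let $j\to\infty$ in $u_i-x=(u_i-u_j)+(u_j-x)$. The index `N`
  -- does not depend on `s`.
  have hbound : ∀ ε > 0, ∃ N, ∀ i ≥ N, ∀ s, partialNorm e X₀ X₁ m s (u i - x) ≤ ε := by
    intro ε hε
    obtain ⟨N, hN⟩ := hc ε hε
    refine ⟨N, fun i hi s => ?_⟩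
    have h1 : Tendsto (fun j => ε + partialNorm e X₀ X₁ m s (u j - x)) atTop (𝓝 ε) := by
      simpa using (hpart s).const_add ε
    refine ge_of_tendsto h1 ?_
    filter_upwards [eventually_ge_atTop N] with j hj
    have h2 := partialNorm_add_le (e := e) (X₀ := X₀) he hm s (sub_mem (hu1 i) (hu1 j))
      (sub_mem (hu1 j) hx)
    rw [sub_add_sub_cancel] at h2
    have h3 := partialNorm_le_wNorm he (hsub (hu i) (hu j)) s
    have h4 := hN i hi j hj
    linarith
  have hxW : x ∈ wSet e X₀ X₁ m := by
    rw [mem_wSet_iff hX]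
    refine ⟨hx, fun ε hε => ?_⟩
    obtain ⟨N, hN⟩ := hbound (ε / 2) (half_pos hε)
    obtain ⟨s, hs⟩ := exists_partialNorm_lt (hu N) (half_pos hε)
    refine ⟨s, fun t ht => ?_⟩
    have h1 := hN N le_rfl t
    have h2 := hs t ht
    have h3 := partialNorm_add_le (e := e) (X₀ := X₀) he hm t (hu1 N)
      (X₁.carrier.smul_mem (-1) (sub_mem (hu1 N) hx))
    rw [partialNorm_smul hm t _ (sub_mem (hu1 N) hx), abs_neg, abs_one, one_mul,
      show u N + (-1 : ℝ) • (u N - x) = x by rw [neg_one_smul]; abel] at h3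
    linarith
  refine ⟨x, hxW, ?_⟩
  rw [Metric.tendsto_atTop]
  intro ε hε
  obtain ⟨N, hN⟩ := hbound (ε / 2) (half_pos hε)
  refine ⟨N, fun i hi => ?_⟩
  rw [Real.dist_eq, sub_zero, abs_of_nonneg (show 0 ≤ wNorm e X₀ X₁ m _ from norm_nonneg _)]
  exact (wNorm_le (hsub (hu i) hxW) (hN i hi)).trans_lt (half_lt_self hε)

/-- The Lions-Peetre space as a Banach function lattice. -/
def lionsPeetreLattice (he : PerfectlyHomogeneous e) (hX : X₀.carrier ≤ X₁.carrier)
    (hm : AdmissibleWeights m) : BanachFunctionLattice where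
  carrier :=
    { carrier := wSet e X₀ X₁ m
      add_mem' := fun ha hb => wSet_add he hX hm ha hb
      zero_mem' := wSet_zero hX hm
      smul_mem' := fun c _ ha => wSet_smul hX hm c ha }
  nrm := Seminorm.of (fun a => wNorm e X₀ X₁ m a.1)
    (fun a b => wNorm_add_le he hX hm a.2 b.2)
    (fun c a => by rw [Real.norm_eq_abs]; exact wNorm_smul hX hm c a.2)
  eq_zero_of_nrm := by
    intro a ha
    obtain ⟨C, hC, h⟩ := exists_normOf_le_wNorm (X₀ := X₀) (X₁ := X₁) he hX hm
    have h1 := h a.1 a.2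
    rw [show wNorm e X₀ X₁ m a.1 = 0 from ha, mul_zero] at h1
    exact Subtype.ext (eq_zero_of_normOf (mem_of_mem_wSet hX a.2)
      (le_antisymm h1 (normOf_nonneg _)))
  complete := by
    intro u hu
    obtain ⟨x, hx, hlim⟩ := wSet_complete he hX hm (fun n => (u n).2) hu
    exact ⟨⟨x, hx⟩, hlim⟩
  ideal := by
    intro f g hg h
    rw [abs_le_abs_iff] at h
    exact ⟨wSet_of_abs_le he hX hm hg h, wNorm_mono he hX hm hg h⟩

theorem isLionsPeetre_lionsPeetreLattice (he : PerfectlyHomogeneous e)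
    (hX : X₀.carrier ≤ X₁.carrier) (hm : AdmissibleWeights m) :
    IsLionsPeetre (lionsPeetreLattice he hX hm) e X₀.toBanachFunctionLattice
      X₁.toBanachFunctionLattice (fun n => (m n)⁻¹) m :=
  ⟨rfl, fun _ => rfl⟩

theorem normOf_lionsPeetreLattice (he : PerfectlyHomogeneous e)
    (hX : X₀.carrier ≤ X₁.carrier) (hm : AdmissibleWeights m) {a : L0} (ha : a ∈ wSet e X₀ X₁ m) :
    (lionsPeetreLattice he hX hm).normOf a = wNorm e X₀ X₁ m a :=
  normOf_of_mem (X := lionsPeetreLattice he hX hm) ha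

end LionsPeetreSpace

/-! ### Shrinking supports, absolute continuity of the norm, separability. -/

theorem StrictlyEmbedded.tendsto_normOf {X₀ X₁ : BanachFunctionLattice}
    (h : StrictlyEmbedded X₀ X₁) {b : ℕ → L0} (hb : ∀ k, b k ∈ X₀.carrier) {C : ℝ}
    (hC : ∀ k, X₀.normOf (b k) ≤ C) (hs : Tendsto (fun k => leb01 {t | b k t ≠ 0}) atTop (𝓝 0)) :
    Tendsto (fun k => X₁.normOf (b k)) atTop (𝓝 0) := by
  obtain ⟨hle, h⟩ := h
  refine (h (fun k => X₀.mk' (b k) (hb k)) ⟨C, fun k => ?_⟩ hs).congr fun k => norm_mk' _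
  rw [norm_mk']
  exact hC k

section AbsoluteContinuity

variable {E : Type*} [NormedAddCommGroup E] [NormedSpace ℝ E]
  {e : ℕ → E} {X₀ X₁ : RISpace} {m : ℕ → ℝ}

/-- On bounded sequences in the Lions-Peetre space with shrinking supports, the norm of `X₁` tends
to zero. -/
theorem tendsto_normOf_of_wNorm_le (he : PerfectlyHomogeneous e)
    (hX : StrictlyEmbedded X₀.toBanachFunctionLattice X₁.toBanachFunctionLattice)
    (hm : AdmissibleWeights m) {a : ℕ → L0} (ha : ∀ k, a k ∈ wSet e X₀ X₁ m) {M : ℝ}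
    (hM : ∀ k, wNorm e X₀ X₁ m (a k) ≤ M)
    (hs : Tendsto (fun k => leb01 {t | a k t ≠ 0}) atTop (𝓝 0)) :
    Tendsto (fun k => X₁.normOf (a k)) atTop (𝓝 0) := by
  obtain ⟨hle, -⟩ := id hX
  have hM0 : 0 ≤ M := (norm_nonneg _).trans (hM 0)
  rw [Metric.tendsto_atTop]
  intro ε hε
  -- This `n` makes the `X₁` part of every decomposition smaller than $\varepsilon/2$; the `X₀`
  -- parts are then bounded by $m_n(M+1)$. The extra $1$ allows decompositions that are only nearly
  -- optimal.
  obtain ⟨n, hn⟩ : ∃ n, (M + 1) * (m n)⁻¹ < ε / 2 := by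
    have h1 := hm.summable.tendsto_atTop_zero.const_mul (M + 1)
    rw [mul_zero] at h1
    exact (h1.eventually (gt_mem_nhds (half_pos hε))).exists
  have hmn := hm.pos n
  have hdec : ∀ k, ∃ b ∈ X₀.carrier, ∃ c ∈ X₁.carrier,
      a k = b + c ∧ (m n)⁻¹ * X₀.normOf b + m n * X₁.normOf c < M + 1 := by
    intro k
    refine exists_of_kFunctional_lt (ha k).1 ?_
    have h1 := weightedK_le_partialNorm (X₀ := X₀) (X₁ := X₁) (m := m) he
      (Finset.mem_singleton_self n) (a k)
    have h2 := partialNorm_le_wNorm he (ha k) {n}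
    have h3 := hM k
    have h4 : weightedK X₀ X₁ m n (a k) < M + 1 := by linarith
    exact h4
  choose b hb c hc hac hlt using hdec
  have hA : ∀ k, MeasurableSet {t | a k t ≠ 0} := fun k =>
    (a k).measurable (measurableSet_singleton (0 : ℝ)).compl
  -- The piece `b k` need not have small support, but cutting both pieces to the support of `a k`
  -- loses nothing, and strictness then applies.
  have hb' : Tendsto (fun k => X₁.normOf (cutoff _ (hA k) (b k))) atTop (𝓝 0) := by
    refine hX.tendsto_normOf (fun k => mem_of_abs_le (hb k) (abs_cutoff_le (b k)))
      (C := m n * (M + 1)) (fun k => (normOf_mono (hb k) (abs_cutoff_le (b k))).trans ?_) ?_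
    · have h1 : 0 ≤ X₁.normOf (c k) := normOf_nonneg _
      have h2 : (m n)⁻¹ * X₀.normOf (b k) ≤ M + 1 := by nlinarith [hlt k]
      rwa [inv_mul_le_iff₀ hmn] at h2
    · refine tendsto_of_tendsto_of_tendsto_of_le_of_le tendsto_const_nhds hs
        (fun k => zero_le) fun k => measure_mono_ae ?_
      filter_upwards [coeFn_cutoff (hA := hA k) (b k)] with t ht h1
      by_contra h2
      refine h1 ?_
      show cutoff _ (hA k) (b k) t = 0
      rw [ht, indicator_of_notMem h2]
  obtain ⟨N, hN⟩ := (Metric.tendsto_atTop.1 hb') (ε / 2) (half_pos hε)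
  refine ⟨N, fun k hk => ?_⟩
  have h1 := hN k hk
  rw [Real.dist_eq, sub_zero, abs_of_nonneg (normOf_nonneg _)] at h1 ⊢
  have hb1 : cutoff _ (hA k) (b k) ∈ X₁.carrier :=
    mem_of_abs_le (hle (hb k)) (abs_cutoff_le (b k))
  have hc1 : cutoff _ (hA k) (c k) ∈ X₁.carrier := mem_of_abs_le (hc k) (abs_cutoff_le (c k))
  have hcut : a k = cutoff _ (hA k) (b k) + cutoff _ (hA k) (c k) := by
    rw [← map_add, ← hac k]
    refine AEEqFun.ext ?_
    filter_upwards [coeFn_cutoff (hA := hA k) (a k)] with t ht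
    rw [ht]
    by_cases h0 : a k t = 0
    · rw [indicator_of_notMem (show t ∉ {t | a k t ≠ 0} from
        fun h => (show a k t ≠ 0 from h) h0), h0]
    · rw [indicator_of_mem (show t ∈ {t | a k t ≠ 0} from h0)]
  have h2 : X₁.normOf (c k) ≤ (M + 1) * (m n)⁻¹ := by
    rw [← div_eq_mul_inv, le_div_iff₀ hmn]
    have : 0 ≤ (m n)⁻¹ * X₀.normOf (b k) := mul_nonneg (inv_nonneg.2 hmn.le) (normOf_nonneg _)
    linarith [hlt k]
  have h3 : X₁.normOf (cutoff _ (hA k) (c k)) ≤ X₁.normOf (c k) :=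
    normOf_mono (hc k) (abs_cutoff_le (c k))
  have h4 := normOf_add_le hb1 hc1
  rw [← hcut] at h4
  linarith

/-- Each coordinate is at most $m_n\|\cdot\|_{X_1}$. This is the coordinatewise nullity that the
gliding hump needs. -/
theorem tendsto_partialNorm_of_wNorm_le (he : PerfectlyHomogeneous e)
    (hX : StrictlyEmbedded X₀.toBanachFunctionLattice X₁.toBanachFunctionLattice)
    (hm : AdmissibleWeights m) {a : ℕ → L0} (ha : ∀ k, a k ∈ wSet e X₀ X₁ m) {M : ℝ}
    (hM : ∀ k, wNorm e X₀ X₁ m (a k) ≤ M)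
    (hs : Tendsto (fun k => leb01 {t | a k t ≠ 0}) atTop (𝓝 0)) (s : Finset ℕ) :
    Tendsto (fun k => partialNorm e X₀ X₁ m s (a k)) atTop (𝓝 0) := by
  have h := tendsto_normOf_of_wNorm_le he hX hm ha hM hs
  refine squeeze_zero (fun k => partialNorm_nonneg s _) (fun k => partialNorm_le_sum he hm s _) ?_
  rw [← Finset.sum_const_zero (s := s) (M := ℝ)]
  refine tendsto_finsetSum s fun n _ => ?_
  refine squeeze_zero (fun k => weightedK_nonneg hm n _)
    (fun k => weightedK_le_mul_normOf hm n (mem_of_mem_wSet hX.1 (ha k))) ?_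
  simpa using h.const_mul (m n)

/-- The norm of the Lions-Peetre space is absolutely continuous. -/
theorem tendsto_wNorm_cutoff [CompleteSpace E] (he : PerfectlyHomogeneous e)
    (hX : StrictlyEmbedded X₀.toBanachFunctionLattice X₁.toBanachFunctionLattice)
    (hm : AdmissibleWeights m) {a : L0} (ha : a ∈ wSet e X₀ X₁ m) {A : ℕ → Set ℝ}
    (hA : ∀ k, MeasurableSet (A k)) (hs : Tendsto (fun k => leb01 (A k)) atTop (𝓝 0)) :
    Tendsto (fun k => wNorm e X₀ X₁ m (cutoff (A k) (hA k) a)) atTop (𝓝 0) := by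
  classical
  have hmem : ∀ k, cutoff (A k) (hA k) a ∈ wSet e X₀ X₁ m := fun k =>
    wSet_of_abs_le he hX.1 hm ha (abs_cutoff_le a)
  have hsupp : Tendsto (fun k => leb01 {t | cutoff (A k) (hA k) a t ≠ 0}) atTop (𝓝 0) := by
    refine tendsto_of_tendsto_of_tendsto_of_le_of_le tendsto_const_nhds hs
      (fun k => zero_le) fun k => measure_mono_ae ?_
    filter_upwards [coeFn_cutoff (hA := hA k) a] with t ht h1
    by_contra h2
    refine h1 ?_
    show cutoff _ (hA k) a t = 0
    rw [ht, indicator_of_notMem h2]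
  rw [Metric.tendsto_atTop]
  intro ε hε
  -- Off `s` all restrictions of `a` are dominated by `a` itself; on `s` the shrinking supports
  -- decide.
  obtain ⟨s, hs'⟩ := exists_partialNorm_lt ha (show 0 < ε / 4 by linarith)
  have h1 := tendsto_partialNorm_of_wNorm_le he hX hm hmem
    (fun k => wNorm_mono he hX.1 hm ha (abs_cutoff_le a)) hsupp s
  obtain ⟨N, hN⟩ := (Metric.tendsto_atTop.1 h1) (ε / 4) (by linarith)
  refine ⟨N, fun k hk => ?_⟩
  have h2 := hN k hk
  rw [Real.dist_eq, sub_zero] at h2 ⊢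
  rw [abs_of_nonneg (partialNorm_nonneg _ _)] at h2
  rw [abs_of_nonneg (show 0 ≤ wNorm e X₀ X₁ m _ from norm_nonneg _)]
  refine lt_of_le_of_lt (wNorm_le (hmem k) (r := ε / 2) fun t => ?_) (half_lt_self hε)
  have h3 := partialNorm_le_inter_add_sdiff (e := e) (X₀ := X₀) (X₁ := X₁) (m := m) t s
    (cutoff (A k) (hA k) a)
  have h4 := partialNorm_mono_set (X₀ := X₀) (X₁ := X₁) (m := m) he
    (Finset.inter_subset_right (s₁ := t) (s₂ := s)) (cutoff (A k) (hA k) a)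
  have h5 := partialNorm_mono (X₀ := X₀) he hm (t \ s) (mem_of_mem_wSet hX.1 ha)
    (abs_cutoff_le (hA := hA k) a)
  have h6 := hs' (t \ s) Finset.sdiff_disjoint
  linarith

end AbsoluteContinuity

/-- A Banach function lattice with absolutely continuous norm is separable. -/
theorem BanachFunctionLattice.separableSpace_of_absolutelyContinuous (X : BanachFunctionLattice)
    (h1 : one ∈ X.carrier)
    (hac : ∀ f ∈ X.carrier, ∀ (A : ℕ → Set ℝ) (hA : ∀ k, MeasurableSet (A k)),
      Tendsto (fun k => leb01 (A k)) atTop (𝓝 0) →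
        Tendsto (fun k => X.normOf (cutoff (A k) (hA k) f)) atTop (𝓝 0)) :
    TopologicalSpace.SeparableSpace X.Elem := by
  -- Functions bounded by `M` with the separable $L_1$ metric. Their inclusions into `X` are
  -- continuous, and truncation makes the union of the images dense.
  let S : ℕ → Type := fun M => {f : Lp ℝ 1 leb01 // ∀ᵐ t ∂leb01, |f t| ≤ M}
  have hmemS : ∀ (M : ℕ) (f : L0), (∀ᵐ t ∂leb01, |f t| ≤ M) → f ∈ X.carrier := by
    intro M f hf
    refine mem_of_abs_le (X.carrier.smul_mem (M : ℝ) h1) ?_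
    filter_upwards [hf, coeFn_one, AEEqFun.coeFn_smul (M : ℝ) one] with t e1 e2 e3
    rw [e3, Pi.smul_apply, e2, smul_eq_mul, mul_one, Nat.abs_cast]
    exact e1
  let g : ∀ M, S M → X.Elem := fun M f => X.mk' (f.1 : L0) (hmemS M _ f.2)
  have hg : ∀ M, Continuous (g M) := by
    intro M
    refine continuous_iff_seqContinuous.2 fun u f hu => ?_
    have hu' : Tendsto (fun k => (u k).1) atTop (𝓝 f.1) :=
      (continuous_subtype_val.tendsto f).comp hu
    have hmeas := tendstoInMeasure_of_tendsto_Lp hu'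
    rw [tendsto_iff_norm_sub_tendsto_zero, Metric.tendsto_atTop]
    intro ε hε
    set δ : ℝ := ε / (2 * (X.normOf one + 1)) with hδ
    have hone : 0 ≤ X.normOf one := normOf_nonneg _
    have hδ0 : 0 < δ := by positivity
    have hA : ∀ k, MeasurableSet {t | δ ≤ |(u k).1.1 t - f.1.1 t|} := fun k =>
      measurableSet_le measurable_const ((u k).1.1.measurable.sub f.1.1.measurable).norm
    have hAlim : Tendsto (fun k => leb01 {t | δ ≤ |(u k).1.1 t - f.1.1 t|}) atTop (𝓝 0) := by
      have := tendstoInMeasure_iff_norm.1 hmeas δ hδ0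
      exact this
    have hlim := (hac one h1 _ hA hAlim).const_mul (2 * M : ℝ)
    rw [mul_zero] at hlim
    obtain ⟨N, hN⟩ := Metric.tendsto_atTop.1 hlim (ε / 2) (half_pos hε)
    refine ⟨N, fun k hk => ?_⟩
    have h2 := hN k hk
    have hnn : 0 ≤ X.normOf (cutoff _ (hA k) one) := normOf_nonneg _
    rw [Real.dist_eq, sub_zero] at h2 ⊢
    rw [abs_of_nonneg (by positivity)] at h2
    rw [abs_of_nonneg (norm_nonneg _)]
    have hcm : cutoff _ (hA k) one ∈ X.carrier := mem_of_abs_le h1 (abs_cutoff_le one)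
    -- The difference is below `δ` off a set of small measure and at most $2M$ on it; `δ` is chosen
    -- so that $\delta\|1\|<\varepsilon/2$.
    have hle : X.normOf ((u k).1.1 - f.1.1) ≤
        X.normOf (δ • one + (2 * M : ℝ) • cutoff _ (hA k) one) := by
      refine normOf_mono (add_mem (X.carrier.smul_mem _ h1) (X.carrier.smul_mem _ hcm)) ?_
      filter_upwards [AEEqFun.coeFn_sub (u k).1.1 f.1.1, (u k).2, f.2,
        AEEqFun.coeFn_add (δ • one) ((2 * M : ℝ) • cutoff _ (hA k) one),
        AEEqFun.coeFn_smul δ one, AEEqFun.coeFn_smul (2 * M : ℝ) (cutoff _ (hA k) one), coeFn_one,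
        coeFn_cutoff_one (hA := hA k)] with t e1 e2 e3 e4 e5 e6 e7 e8
      rw [e1, Pi.sub_apply, e4, Pi.add_apply, e5, e6, Pi.smul_apply, Pi.smul_apply, e7, e8,
        smul_eq_mul, smul_eq_mul, mul_one]
      refine le_trans ?_ (le_abs_self _)
      by_cases ht : t ∈ {t | δ ≤ |(u k).1.1 t - f.1.1 t|}
      · rw [indicator_of_mem ht, Pi.one_apply, mul_one]
        have e9 := abs_sub ((u k).1.1 t) (f.1.1 t)
        linarith
      · rw [indicator_of_notMem ht, mul_zero, add_zero]
        exact (not_le.1 ht).le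
    have h3 := normOf_add_le (X.carrier.smul_mem δ h1) (X.carrier.smul_mem (2 * M : ℝ) hcm)
    rw [normOf_smul _ h1, normOf_smul _ hcm, abs_of_pos hδ0,
      abs_of_nonneg (by positivity : (0 : ℝ) ≤ 2 * M)] at h3
    have h4 : δ * X.normOf one < ε / 2 := by
      rw [hδ, div_mul_eq_mul_div, div_lt_div_iff₀ (by positivity) two_pos]
      nlinarith
    have h5 : ‖(g M ∘ u) k - g M f‖ = X.normOf ((u k).1.1 - f.1.1) := by
      rw [← normOf_toFun]
      rfl
    rw [h5]
    linarith
  have hsep : TopologicalSpace.IsSeparable (closure (⋃ M, range (g M))) := by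
    refine (TopologicalSpace.IsSeparable.iUnion fun M => ?_).closure
    have : Fact ((1 : ℝ≥0∞) ≠ ∞) := ⟨ENNReal.one_ne_top⟩
    have : SecondCountableTopology (S M) := TopologicalSpace.Subtype.secondCountableTopology _
    exact TopologicalSpace.isSeparable_range (hg M)
  rw [← TopologicalSpace.isSeparable_univ_iff]
  refine hsep.mono fun x _ => ?_
  have hA : ∀ M : ℕ, MeasurableSet {t | (M : ℝ) < |x.toFun t|} := fun M =>
    measurableSet_lt measurable_const x.toFun.measurable.norm
  have hmeas : Tendsto (fun M : ℕ => leb01 {t | (M : ℝ) < |x.toFun t|}) atTop (𝓝 0) := by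
    have h2 : (⋂ M : ℕ, {t | (M : ℝ) < |x.toFun t|}) = ∅ := by
      ext t
      simp only [mem_iInter, mem_ofPred_eq, mem_empty_iff_false, iff_false, not_forall, not_lt]
      exact exists_nat_ge _
    have h3 := tendsto_measure_iInter_atTop (μ := leb01)
      (s := fun M : ℕ => {t | (M : ℝ) < |x.toFun t|}) (fun M => (hA M).nullMeasurableSet)
      (fun i j hij t (ht : (j : ℝ) < |x.toFun t|) => lt_of_le_of_lt (Nat.cast_le.2 hij) ht)
      ⟨0, measure_ne_top _ _⟩
    rwa [h2, measure_empty] at h3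
  have hlim := hac _ x.mem _ hA hmeas
  have hbdd : ∀ M : ℕ, ∀ᵐ t ∂leb01, |(x.toFun - cutoff _ (hA M) x.toFun) t| ≤ M := by
    intro M
    filter_upwards [AEEqFun.coeFn_sub x.toFun (cutoff _ (hA M) x.toFun),
      coeFn_cutoff (hA := hA M) x.toFun] with t e1 e2
    rw [e1, Pi.sub_apply, e2]
    by_cases ht : t ∈ {t | (M : ℝ) < |x.toFun t|}
    · rw [indicator_of_mem ht]
      simp
    · rw [indicator_of_notMem ht, sub_zero]
      exact not_lt.1 ht
  have hLp : ∀ M : ℕ, x.toFun - cutoff _ (hA M) x.toFun ∈ Lp ℝ 1 leb01 := fun M =>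
    Lp.mem_Lp_iff_memLp.2 (MemLp.of_bound (AEEqFun.aestronglyMeasurable _) M (hbdd M))
  refine mem_closure_of_tendsto (f := fun M : ℕ => g M ⟨⟨_, hLp M⟩, hbdd M⟩) (b := atTop) ?_
    (Eventually.of_forall fun M => mem_iUnion.2 ⟨M, mem_range_self _⟩)
  rw [tendsto_iff_norm_sub_tendsto_zero]
  refine hlim.congr fun M => ?_
  rw [← normOf_toFun, ← normOf_neg]
  congr 1
  show -cutoff _ (hA M) x.toFun = x.toFun - cutoff _ (hA M) x.toFun - x.toFun
  abel

/-! ### The Lions-Peetre space is rearrangement invariant. -/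

section RearrangementInvariance

variable {E : Type*} [NormedAddCommGroup E] [NormedSpace ℝ E]
  {e : ℕ → E} {X₀ X₁ : RISpace} {m : ℕ → ℝ}

theorem wSet_of_equimeasurable (hX : X₀.carrier ≤ X₁.carrier) (hm : AdmissibleWeights m)
    {f g : L0} (h : Equimeasurable f g) (hg : g ∈ wSet e X₀ X₁ m) :
    f ∈ wSet e X₀ X₁ m ∧ wNorm e X₀ X₁ m f = wNorm e X₀ X₁ m g := by
  have hg1 := mem_of_mem_wSet hX hg
  have hf1 := RISpace.mem_of_equimeasurable h hg1
  have hk : ∀ n, weightedK X₀ X₁ m n f = weightedK X₀ X₁ m n g := fun n =>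
    le_antisymm
      (kFunctional_le_of_equimeasurable (inv_nonneg.2 (hm.pos n).le) (hm.pos n).le hg1 X₁.one_mem
        h.symm)
      (kFunctional_le_of_equimeasurable (inv_nonneg.2 (hm.pos n).le) (hm.pos n).le hf1 X₁.one_mem h)
  refine ⟨⟨le_sup_right (α := Submodule ℝ L0) hf1, ?_⟩, ?_⟩
  · exact hg.2.congr fun n => congrArg (· • e n) (hk n).symm
  · unfold wNorm lionsPeetreNorm
    exact congrArg norm (tsum_congr fun n => congrArg (· • e n) (hk n))

/-- The Lions-Peetre space as an r.i. space. -/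
def lionsPeetreRISpace [CompleteSpace E] (he : PerfectlyHomogeneous e)
    (hX : StrictlyEmbedded X₀.toBanachFunctionLattice X₁.toBanachFunctionLattice)
    (hm : AdmissibleWeights m) : RISpace where
  toBanachFunctionLattice := lionsPeetreLattice he hX.1 hm
  nontrivial := by
    intro h
    have h1 : one ∈ (lionsPeetreLattice he hX.1 hm).carrier := mem_wSet_of_mem he hm X₀.one_mem
    rw [h, Submodule.mem_bot] at h1
    have hne : (ae leb01).NeBot := by
      rw [ae_neBot]
      intro h0
      have : leb01 univ = 1 := by simp
      rw [h0] at this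
      simp at this
    have h2 : ∀ᵐ t ∂leb01, False := by
      filter_upwards [coeFn_one, AEEqFun.coeFn_zero (α := ℝ) (μ := leb01) (β := ℝ)] with t e1 e2
      rw [h1, e2] at e1
      exact zero_ne_one e1
    exact h2.exists.choose_spec
  rearrangement f g hg h :=
    ⟨(wSet_of_equimeasurable hX.1 hm h hg).1, (wSet_of_equimeasurable hX.1 hm h hg).2⟩
  separable_or_maximal := Or.inl <|
    separableSpace_of_absolutelyContinuous _ (mem_wSet_of_mem he hm X₀.one_mem)
      fun f hf A hA hs => by
        refine (tendsto_wNorm_cutoff he hX hm hf hA hs).congr fun k => ?_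
        exact (normOf_lionsPeetreLattice he hX.1 hm
          (wSet_of_abs_le he hX.1 hm hf (abs_cutoff_le f))).symm

end RearrangementInvariance

/-! ### Norming functionals and projections. -/

/-- A vector has a norming functional for any seminorm. -/
theorem Seminorm.exists_dual_eq {V : Type*} [AddCommGroup V] [Module ℝ V] (p : Seminorm ℝ V)
    (v : V) : ∃ g : V →ₗ[ℝ] ℝ, g v = p v ∧ ∀ x, |g x| ≤ p x := by
  rcases eq_or_ne v 0 with rfl | hv
  · exact ⟨0, by simp, fun x => by simp⟩
  obtain ⟨g, hg, hle⟩ := Module.Dual.exists_extension_of_le_seminorm_real _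
    (LinearPMap.mkSpanSingleton (K := ℝ) v (p v) hv).toFun (p := p) (by
      rintro ⟨x, hx⟩
      obtain ⟨c, rfl⟩ := Submodule.mem_span_singleton.1 hx
      have h1 : (LinearPMap.mkSpanSingleton (K := ℝ) v (p v) hv).toFun ⟨c • v, hx⟩ = c • p v :=
        LinearPMap.mkSpanSingleton'_apply (σ := RingHom.id ℝ) v (p v) _ c hx
      rw [h1, map_smul_eq_mul, smul_eq_mul, Real.norm_eq_abs]
      exact mul_le_mul_of_nonneg_right (le_abs_self c) (apply_nonneg p v))
  refine ⟨g, ?_, hle⟩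
  rw [hg ⟨v, Submodule.mem_span_singleton_self v⟩]
  exact LinearPMap.mkSpanSingleton'_apply_self (σ := RingHom.id ℝ) v (p v) _ _

/-- A sequence with a biorthogonal sequence of functionals whose partial sum operators are
uniformly bounded and pointwise convergent has complemented closed span. -/
theorem closedComplemented_span_of_biorthogonal {V : Type*} [NormedAddCommGroup V]
    [NormedSpace ℝ V] (v : ℕ → V) (g : ℕ → V →ₗ[ℝ] ℝ)
    (hgv : ∀ i j, g j (v i) = if i = j then 1 else 0)
    (hsum : ∀ a, Summable fun j => g j a • v j) {C : ℝ}
    (hC : ∀ (s : Finset ℕ) (a : V), ‖∑ j ∈ s, g j a • v j‖ ≤ C * ‖a‖) :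
    (Submodule.span ℝ (range v)).topologicalClosure.ClosedComplemented := by
  let P₀ : V →ₗ[ℝ] V :=
    { toFun := fun a => ∑' j, g j a • v j
      map_add' := fun a b => by
        rw [← (hsum a).tsum_add (hsum b)]
        exact tsum_congr fun j => by rw [map_add, add_smul]
      map_smul' := fun c a => by
        rw [RingHom.id_apply, ← tsum_const_smul'']
        exact tsum_congr fun j => by rw [map_smul, smul_assoc] }
  let P : V →L[ℝ] V := P₀.mkContinuous C fun a => le_of_tendsto' (hsum a).hasSum.norm
    fun s => hC s a
  have hP : ∀ a, P a = ∑' j, g j a • v j := fun a => rfl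
  have hmem : ∀ a, P a ∈ (Submodule.span ℝ (range v)).topologicalClosure := by
    intro a
    refine mem_closure_of_tendsto (hsum a).hasSum (Eventually.of_forall fun s => ?_)
    exact sum_mem fun j _ => Submodule.smul_mem _ _ (Submodule.subset_span (mem_range_self j))
  have hid : ∀ x ∈ (Submodule.span ℝ (range v)).topologicalClosure, P x = x := by
    have hspan : ∀ x ∈ Submodule.span ℝ (range v), P x = x := by
      have : Submodule.span ℝ (range v) ≤ LinearMap.eqLocus P.toLinearMap LinearMap.id := by
        rw [Submodule.span_le]
        rintro _ ⟨i, rfl⟩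
        show P (v i) = v i
        rw [hP, tsum_eq_single i fun j hj => by rw [hgv, if_neg hj.symm, zero_smul], hgv,
          if_pos rfl, one_smul]
      exact fun x hx => this hx
    intro x hx
    have hcl : IsClosed {x | P x = x} := isClosed_eq P.continuous continuous_id
    exact closure_minimal (fun y hy => hspan y hy) hcl hx
  exact ⟨P.codRestrict _ hmem, fun x => Subtype.ext (hid x x.2)⟩

/-! ### Disjoint sequences. -/

namespace BanachFunctionLattice

variable {X : BanachFunctionLattice}

instance (X : BanachFunctionLattice) : CompleteSpace X.Elem := by
  refine Metric.complete_of_cauchySeq_tendsto fun u hu => ?_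
  obtain ⟨x, hx⟩ := X.complete u fun ε hε => by
    obtain ⟨N, hN⟩ := Metric.cauchySeq_iff.1 hu ε hε
    refine ⟨N, fun i hi j hj => ?_⟩
    have h := hN i hi j hj
    rw [dist_eq_norm] at h
    exact h
  exact ⟨x, tendsto_iff_norm_sub_tendsto_zero.2 hx⟩

/-- The inclusion of the lattice in the space of functions. -/
def toFunₗ (X : BanachFunctionLattice) : X.Elem →ₗ[ℝ] L0 := X.carrier.subtype

theorem toFunₗ_apply (x : X.Elem) : X.toFunₗ x = x.toFun := rfl

theorem toFun_injective {x y : X.Elem} (h : x.toFun = y.toFun) : x = y := Subtype.ext h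

/-- The restriction to a measurable set, as an operator in the lattice. -/
def cutoffₗ (X : BanachFunctionLattice) (A : Set ℝ) (hA : MeasurableSet A) :
    X.Elem →ₗ[ℝ] X.Elem where
  toFun x := X.mk' (cutoff A hA x.toFun) (mem_of_abs_le x.mem (abs_cutoff_le _))
  map_add' x y := toFun_injective (map_add (cutoff A hA) x.toFun y.toFun)
  map_smul' c x := toFun_injective (map_smul (cutoff A hA) c x.toFun)

theorem toFun_cutoffₗ {A : Set ℝ} {hA : MeasurableSet A} (x : X.Elem) :
    (X.cutoffₗ A hA x).toFun = cutoff A hA x.toFun := rfl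

/-- There are countably many pairs, so one null set serves them all. -/
theorem DisjointSeq.ae {x : ℕ → X.Elem} (hx : DisjointSeq x) :
    ∀ᵐ t ∂leb01, ∀ i j, i ≠ j → (x i).toFun t = 0 ∨ (x j).toFun t = 0 := by
  rw [ae_all_iff]
  intro i
  rw [ae_all_iff]
  intro j
  by_cases hij : i = j
  · exact Eventually.of_forall fun t h => absurd hij h
  filter_upwards [AEEqFun.coeFn_inf |(x i).toFun| |(x j).toFun|, AEEqFun.coeFn_abs (x i).toFun,
    AEEqFun.coeFn_abs (x j).toFun, AEEqFun.coeFn_zero (α := ℝ) (μ := leb01) (β := ℝ)]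
    with t h1 h2 h3 h4 _
  rw [hx i j hij, h4, h2, h3, Pi.zero_apply] at h1
  rcases min_choice |(x i).toFun t| |(x j).toFun t| with h | h
  · exact Or.inl (abs_eq_zero.1 (h ▸ h1.symm))
  · exact Or.inr (abs_eq_zero.1 (h ▸ h1.symm))

theorem DisjointSeq.comp {x : ℕ → X.Elem} (hx : DisjointSeq x) {φ : ℕ → ℕ}
    (hφ : Function.Injective φ) : DisjointSeq (x ∘ φ) :=
  fun _ _ hij => hx _ _ fun h => hij (hφ h)

/-- Almost disjoint sets in a finite measure space have summable measures. -/
theorem DisjointSeq.tendsto_measure_support {x : ℕ → X.Elem} (hx : DisjointSeq x) :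
    Tendsto (fun k => leb01 {t | (x k).toFun t ≠ 0}) atTop (𝓝 0) := by
  refine ENNReal.tendsto_atTop_zero_of_tsum_ne_top (ne_top_of_le_ne_top (measure_ne_top leb01 univ)
    (tsum_measure_le_measure_univ (fun i => ?_) fun i j hij => ?_))
  · exact ((x i).toFun.measurable (measurableSet_singleton (0 : ℝ)).compl).nullMeasurableSet
  · refine measure_mono_null ?_ (ae_iff.1 hx.ae)
    rintro t ⟨h1, h2⟩ h
    exact (h i j hij).elim h1 h2

theorem coeFn_sum_smul (x : ℕ → X.Elem) (s : Finset ℕ) (c : ℕ → ℝ) :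
    ∀ᵐ t ∂leb01, (∑ j ∈ s, c j • x j : X.Elem).toFun t = ∑ j ∈ s, c j * (x j).toFun t := by
  have h0 : (∑ j ∈ s, c j • x j : X.Elem).toFun = ∑ j ∈ s, c j • (x j).toFun := by
    rw [← toFunₗ_apply, map_sum]
    rfl
  have h1 : ∀ᵐ t ∂leb01, ∀ j, (c j • (x j).toFun) t = c j * (x j).toFun t := by
    rw [ae_all_iff]
    intro j
    filter_upwards [AEEqFun.coeFn_smul (c j) (x j).toFun] with t ht
    rw [ht]
    rfl
  rw [h0]
  filter_upwards [h1, AEEqFun.coeFn_fun_finsetSum s fun j => c j • (x j).toFun] with t h2 h3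
  rw [h3]
  exact Finset.sum_congr rfl fun j _ => h2 j

/-- At almost every point at most one term of the sum is nonzero. -/
theorem DisjointSeq.abs_le_abs_sum {x : ℕ → X.Elem} (hx : DisjointSeq x) (s : Finset ℕ) (c : ℕ → ℝ)
    {j : ℕ} (hj : j ∈ s) :
    ∀ᵐ t ∂leb01, |(c j • x j : X.Elem).toFun t| ≤ |(∑ i ∈ s, c i • x i : X.Elem).toFun t| := by
  have h0 := coeFn_sum_smul x {j} c
  simp only [Finset.sum_singleton] at h0
  filter_upwards [h0, coeFn_sum_smul x s c, hx.ae] with t h1 h2 h3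
  rw [h1, h2]
  by_cases h : (x j).toFun t = 0
  · rw [h, mul_zero, abs_zero]
    exact abs_nonneg _
  · rw [Finset.sum_eq_single_of_mem j hj fun i _ hij => by
      rw [(h3 i j hij).resolve_right h, mul_zero]]

theorem DisjointSeq.cutoffₗ_eq {x : ℕ → X.Elem} (hx : DisjointSeq x) (i j : ℕ)
    (hA : MeasurableSet {t | (x j).toFun t ≠ 0}) :
    X.cutoffₗ _ hA (x i) = if i = j then x i else 0 := by
  refine toFun_injective (AEEqFun.ext ?_)
  filter_upwards [coeFn_cutoff (hA := hA) (x i).toFun, hx.ae,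
    AEEqFun.coeFn_zero (α := ℝ) (μ := leb01) (β := ℝ)] with t h1 h2 h3
  rw [toFun_cutoffₗ, h1]
  split_ifs with hij
  · subst hij
    by_cases h : (x i).toFun t = 0
    · rw [indicator_of_notMem (show t ∉ {t | (x i).toFun t ≠ 0} from
        fun h' => (show (x i).toFun t ≠ 0 from h') h), h]
    · rw [indicator_of_mem (show t ∈ {t | (x i).toFun t ≠ 0} from h)]
  · have h4 : ((0 : X.Elem).toFun : ℝ → ℝ) t = 0 := h3
    rw [h4]
    rcases h2 i j hij with h | h
    · by_cases h' : t ∈ {t | (x j).toFun t ≠ 0}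
      · rw [indicator_of_mem h', h]
      · rw [indicator_of_notMem h']
    · rw [indicator_of_notMem (show t ∉ {t | (x j).toFun t ≠ 0} from
        fun h' => (show (x j).toFun t ≠ 0 from h') h)]

end BanachFunctionLattice

/-! ### Gliding hump, two-sided estimates, complementation. -/

section Blocks

variable {E : Type*} [NormedAddCommGroup E] [NormedSpace ℝ E]
  {e : ℕ → E} {X₀ X₁ : RISpace} {m : ℕ → ℝ}

/-- The block property reassembles the localized norms of one function into its partial norm over
the union. -/
theorem norm_sum_partialNorm_smul (he : PerfectlyHomogeneous e) {I : ℕ → Finset ℕ}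
    (hI : Pairwise (Function.onFun Disjoint I)) (s : Finset ℕ) (a : L0) :
    ‖∑ j ∈ s, partialNorm e X₀ X₁ m (I j) a • e j‖ = partialNorm e X₀ X₁ m (s.biUnion I) a := by
  unfold partialNorm
  rw [Finset.sum_biUnion fun i _ j _ hij => hI hij]
  exact (he.block I hI s fun n => weightedK X₀ X₁ m n a).symm

variable [CompleteSpace E]

/-- The gliding hump: a subsequence of a sequence which is null coordinatewise is concentrated on
disjoint blocks. -/
theorem exists_subsequence_blocks (he : PerfectlyHomogeneous e) {x : ℕ → L0}
    (hx : ∀ k, x k ∈ wSet e X₀ X₁ m)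
    (hnull : ∀ s, Tendsto (fun k => partialNorm e X₀ X₁ m s (x k)) atTop (𝓝 0)) {δ : ℕ → ℝ}
    (hδ : ∀ j, 0 < δ j) :
    ∃ φ : ℕ → ℕ, StrictMono φ ∧ ∃ I : ℕ → Finset ℕ, Pairwise (Function.onFun Disjoint I) ∧
      ∀ j t, Disjoint t (I j) → partialNorm e X₀ X₁ m t (x (φ j)) ≤ δ j := by
  -- A state holds the last index chosen and the number of coordinates used. The next index has head
  -- below $\delta_j/2$ on the used coordinates; then the block is extended until the tail is below
  -- $\delta_j/2$.
  have step : ∀ (j : ℕ) (p : ℕ × ℕ), ∃ p' : ℕ × ℕ, p.1 < p'.1 ∧ p.2 ≤ p'.2 ∧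
      ∀ t, Disjoint t (Finset.Ico p.2 p'.2) → partialNorm e X₀ X₁ m t (x p'.1) ≤ δ j := by
    rintro j ⟨k, N⟩
    obtain ⟨k', hk', hk⟩ := (((hnull (Finset.range N)).eventually
      (gt_mem_nhds (half_pos (hδ j)))).and (eventually_gt_atTop k)).exists
    obtain ⟨s, hs⟩ := exists_partialNorm_lt (hx k') (half_pos (hδ j))
    obtain ⟨M, hM⟩ := s.exists_nat_subset_range
    refine ⟨(k', max N M), hk, le_max_left _ _, fun t ht => ?_⟩
    have h1 := partialNorm_le_inter_add_sdiff (e := e) (X₀ := X₀) (X₁ := X₁) (m := m) t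
      (Finset.range N) (x k')
    have h2 := partialNorm_mono_set (X₀ := X₀) (X₁ := X₁) (m := m) he
      (Finset.inter_subset_right (s₁ := t) (s₂ := Finset.range N)) (x k')
    have h3 := hs (t \ Finset.range N) (by
      rw [Finset.disjoint_left]
      intro n hn hns
      rw [Finset.mem_sdiff, Finset.mem_range, not_lt] at hn
      exact Finset.disjoint_left.1 ht hn.1 (Finset.mem_Ico.2
        ⟨hn.2, lt_max_of_lt_right (Finset.mem_range.1 (hM hns))⟩))
    simp only at hk' ⊢
    linarith
  choose F hF1 hF2 hF3 using step
  let st : ℕ → ℕ × ℕ := fun n => Nat.rec (0, 0) (fun j p => F j p) n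
  have hst : ∀ j, st (j + 1) = F j (st j) := fun j => rfl
  have hmono : Monotone fun j => (st j).2 := monotone_nat_of_le_succ fun j => by
    simp only [hst]
    exact hF2 j (st j)
  refine ⟨fun j => (st (j + 1)).1, strictMono_nat_of_lt_succ fun j => ?_,
    fun j => Finset.Ico (st j).2 (st (j + 1)).2, ?_, fun j t ht => ?_⟩
  · rw [hst (j + 1)]
    exact hF1 _ _
  · rw [pairwise_disjoint_on]
    intro i j hij
    rw [Finset.disjoint_left]
    intro n hn hn'
    rw [Finset.mem_Ico] at hn hn'
    exact absurd (hmono (show i + 1 ≤ j from hij)) (not_le.2 (lt_of_le_of_lt hn'.1 hn.2))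
  · exact hF3 j (st j) t ht

variable (he : PerfectlyHomogeneous e)
  (hX : StrictlyEmbedded X₀.toBanachFunctionLattice X₁.toBanachFunctionLattice)
  (hm : AdmissibleWeights m)

theorem norm_eq_wNorm (x : (lionsPeetreLattice he hX.1 hm).Elem) :
    ‖x‖ = wNorm e X₀ X₁ m x.toFun := rfl

theorem elem_mem_wSet (x : (lionsPeetreLattice he hX.1 hm).Elem) : x.toFun ∈ wSet e X₀ X₁ m :=
  x.mem

theorem elem_mem (x : (lionsPeetreLattice he hX.1 hm).Elem) : x.toFun ∈ X₁.carrier :=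
  mem_of_mem_wSet hX.1 x.mem

/-- The partial norm as a seminorm on the Lions-Peetre space. -/
def partialSeminorm (s : Finset ℕ) : Seminorm ℝ (lionsPeetreLattice he hX.1 hm).Elem :=
  Seminorm.of (fun x => partialNorm e X₀ X₁ m s x.toFun)
    (fun x y => partialNorm_add_le he hm s (elem_mem he hX hm x) (elem_mem he hX hm y))
    (fun c x => by
      rw [Real.norm_eq_abs]
      exact partialNorm_smul hm s c (elem_mem he hX hm x))

theorem partialSeminorm_apply (s : Finset ℕ) (x : (lionsPeetreLattice he hX.1 hm).Elem) :
    partialSeminorm he hX hm s x = partialNorm e X₀ X₁ m s x.toFun := rfl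

/-- Keep only the coordinates in the blocks: on $I_j$ the sum dominates $c_jv_j$ by disjointness,
and the blocks reassemble by homogeneity. -/
theorem lower_estimate {v : ℕ → (lionsPeetreLattice he hX.1 hm).Elem} (hv : DisjointSeq v)
    {I : ℕ → Finset ℕ} (hI : Pairwise (Function.onFun Disjoint I))
    (hlow : ∀ j, 1 / 2 ≤ partialNorm e X₀ X₁ m (I j) (v j).toFun) (s : Finset ℕ) (c : ℕ → ℝ) :
    1 / 2 * ‖∑ j ∈ s, c j • e j‖ ≤ ‖∑ j ∈ s, c j • v j‖ := by
  have h1 : 1 / 2 * ‖∑ j ∈ s, c j • e j‖ = ‖∑ j ∈ s, (1 / 2 * c j) • e j‖ := by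
    simp_rw [mul_smul]
    rw [← Finset.smul_sum, norm_smul]
    norm_num
  rw [h1, norm_eq_wNorm he hX hm]
  refine le_trans ?_ (partialNorm_le_wNorm he (elem_mem_wSet he hX hm _) (s.biUnion I))
  rw [← norm_sum_partialNorm_smul he hI]
  refine he.mono s _ _ fun j hj => ?_
  rw [abs_of_nonneg (partialNorm_nonneg _ _)]
  refine le_trans ?_ (partialNorm_mono he hm (I j) (elem_mem he hX hm _)
    (hv.abs_le_abs_sum s c hj))
  have h2 : partialNorm e X₀ X₁ m (I j) (c j • v j : (lionsPeetreLattice he hX.1 hm).Elem).toFun =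
      |c j| * partialNorm e X₀ X₁ m (I j) (v j).toFun :=
    partialNorm_smul hm (I j) (c j) (elem_mem he hX hm (v j))
  rw [h2, abs_mul, abs_of_pos (by norm_num : (0 : ℝ) < 1 / 2), mul_comm]
  exact mul_le_mul_of_nonneg_left (hlow j) (abs_nonneg _)

/-- The coordinates of a sum are subadditive. Their parts inside the blocks contribute at most
$\|\sum c_je_j\|$ by homogeneity; those outside contribute at most $\max|c_j|\sum_j2^{-j-1}$, which
is no larger. -/
theorem upper_estimate {v : ℕ → (lionsPeetreLattice he hX.1 hm).Elem} (hv : ∀ j, ‖v j‖ ≤ 1)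
    {I : ℕ → Finset ℕ} (hI : Pairwise (Function.onFun Disjoint I))
    (htail : ∀ j t, Disjoint t (I j) → partialNorm e X₀ X₁ m t (v j).toFun ≤ 1 / 2 / 2 ^ j)
    (s : Finset ℕ) (c : ℕ → ℝ) :
    ‖∑ j ∈ s, c j • v j‖ ≤ 2 * ‖∑ j ∈ s, c j • e j‖ := by
  classical
  rw [norm_eq_wNorm he hX hm]
  refine wNorm_le (elem_mem_wSet he hX hm _) fun t => ?_
  set K : ℕ → ℕ → ℝ := fun j n => |c j| * weightedK X₀ X₁ m n (v j).toFun with hK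
  have hK0 : ∀ j n, 0 ≤ K j n := fun j n => mul_nonneg (abs_nonneg _) (weightedK_nonneg hm n _)
  have hKs : ∀ n, weightedK X₀ X₁ m n
      (∑ j ∈ s, c j • v j : (lionsPeetreLattice he hX.1 hm).Elem).toFun ≤ ∑ j ∈ s, K j n := by
    intro n
    have hsm : ∀ j, weightedK X₀ X₁ m n (c j • v j : (lionsPeetreLattice he hX.1 hm).Elem).toFun =
        K j n := fun j => weightedK_smul hm n (c j) (elem_mem he hX hm (v j))
    induction s using Finset.induction_on with
    | empty =>
      rw [Finset.sum_empty, Finset.sum_empty]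
      have := weightedK_smul (X₀ := X₀) hm n 0 (zero_mem X₁.carrier)
      rw [zero_smul, abs_zero, zero_mul] at this
      exact this.le
    | insert i s his ih =>
      rw [Finset.sum_insert his, Finset.sum_insert his, ← hsm i]
      exact (weightedK_add_le hm n (elem_mem he hX hm (c i • v i)) (elem_mem he hX hm _)).trans
        (add_le_add le_rfl ih)
  have h1 : partialNorm e X₀ X₁ m t
      (∑ j ∈ s, c j • v j : (lionsPeetreLattice he hX.1 hm).Elem).toFun ≤
      ‖∑ n ∈ t, (∑ j ∈ s, K j n) • e n‖ := by
    refine he.mono t _ _ fun n _ => ?_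
    rw [abs_of_nonneg (Finset.sum_nonneg fun j _ => hK0 j n)]
    exact (abs_of_nonneg (weightedK_nonneg hm n _)).trans_le (hKs n)
  have hblock : ∀ (u : Finset ℕ) (j : ℕ), ‖∑ n ∈ u, K j n • e n‖ =
      |c j| * partialNorm e X₀ X₁ m u (v j).toFun := by
    intro u j
    simp_rw [hK, mul_smul]
    rw [← Finset.smul_sum, norm_smul, Real.norm_eq_abs, abs_abs]
    rfl
  have h2 : ∑ n ∈ t, (∑ j ∈ s, K j n) • e n =
      ∑ j ∈ s, ∑ n ∈ t ∩ I j, K j n • e n + ∑ j ∈ s, ∑ n ∈ t \ I j, K j n • e n := by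
    simp_rw [Finset.sum_smul]
    rw [Finset.sum_comm, ← Finset.sum_add_distrib]
    exact Finset.sum_congr rfl fun j _ => (Finset.sum_inter_add_sum_sdiff t (I j) _).symm
  have hI' : Pairwise (Function.onFun Disjoint fun j => t ∩ I j) := fun i j hij =>
    (hI hij).mono Finset.inter_subset_right Finset.inter_subset_right
  have h3 : ‖∑ j ∈ s, ∑ n ∈ t ∩ I j, K j n • e n‖ ≤ ‖∑ j ∈ s, c j • e j‖ := by
    rw [he.norm_sum_block hI' s K]
    refine he.mono s _ _ fun j _ => ?_
    rw [abs_of_nonneg (norm_nonneg _), hblock]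
    refine mul_le_of_le_one_right (abs_nonneg _) ?_
    exact (partialNorm_le_wNorm he (elem_mem_wSet he hX hm (v j)) _).trans (hv j)
  have h4 : ‖∑ j ∈ s, ∑ n ∈ t \ I j, K j n • e n‖ ≤ ‖∑ j ∈ s, c j • e j‖ := by
    calc ‖∑ j ∈ s, ∑ n ∈ t \ I j, K j n • e n‖
        ≤ ∑ j ∈ s, ‖∑ i ∈ s, c i • e i‖ * (1 / 2 / 2 ^ j) := by
          refine (norm_sum_le _ _).trans (Finset.sum_le_sum fun j hj => ?_)
          rw [hblock]
          exact mul_le_mul (he.abs_le hj c) (htail j _ Finset.sdiff_disjoint)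
            (partialNorm_nonneg _ _) (norm_nonneg _)
      _ ≤ ‖∑ i ∈ s, c i • e i‖ * 1 := by
          rw [← Finset.mul_sum]
          gcongr
          refine (Summable.sum_le_tsum s (fun j _ => by positivity)
            (summable_geometric_two' 1)).trans (tsum_geometric_two' 1).le
      _ = _ := mul_one _
  calc _ ≤ _ := h1
    _ = _ := by rw [h2]
    _ ≤ _ := norm_add_le _ _
    _ ≤ 2 * ‖∑ j ∈ s, c j • e j‖ := by linarith

/-- Every normalized disjoint sequence has a subsequence living on disjoint blocks of
coordinates. -/
theorem exists_subsequence_blocks_of_disjointSeq {x : ℕ → (lionsPeetreLattice he hX.1 hm).Elem}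
    (hx : ∀ n, ‖x n‖ = 1) (hd : DisjointSeq x) :
    ∃ φ : ℕ → ℕ, StrictMono φ ∧ ∃ I : ℕ → Finset ℕ, Pairwise (Function.onFun Disjoint I) ∧
      (∀ j, 1 / 2 ≤ partialNorm e X₀ X₁ m (I j) (x (φ j)).toFun) ∧
      ∀ j t, Disjoint t (I j) → partialNorm e X₀ X₁ m t (x (φ j)).toFun ≤ 1 / 2 / 2 ^ j := by
  classical
  have hmem : ∀ k, (x k).toFun ∈ wSet e X₀ X₁ m := fun k => elem_mem_wSet he hX hm (x k)
  obtain ⟨φ, hφ, I, hI, htail⟩ := exists_subsequence_blocks he hmem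
    (tendsto_partialNorm_of_wNorm_le he hX hm hmem (fun k => (hx k).le) hd.tendsto_measure_support)
    (δ := fun j => 1 / 2 / 2 ^ j) (fun j => by positivity)
  refine ⟨φ, hφ, I, hI, fun j => ?_, htail⟩
  -- The tail off $I_j$ is worst at $j=0$, where it is at most $1/2$; half of the unit norm remains
  -- on the block.
  have h1 : wNorm e X₀ X₁ m (x (φ j)).toFun ≤
      partialNorm e X₀ X₁ m (I j) (x (φ j)).toFun + 1 / 2 := by
    refine wNorm_le (hmem _) fun t => (partialNorm_le_inter_add_sdiff t (I j) _).trans ?_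
    refine add_le_add (partialNorm_mono_set he Finset.inter_subset_right _)
      ((htail j _ Finset.sdiff_disjoint).trans ?_)
    exact div_le_self (by norm_num) (one_le_pow₀ (by norm_num))
  have h2 : wNorm e X₀ X₁ m (x (φ j)).toFun = 1 := hx (φ j)
  linarith

theorem disjointlyHomogeneousTo_lionsPeetreLattice :
    (lionsPeetreLattice he hX.1 hm).DisjointlyHomogeneousTo e := by
  intro x hx hd
  obtain ⟨φ, hφ, I, hI, hlow, htail⟩ := exists_subsequence_blocks_of_disjointSeq he hX hm hx hd
  exact ⟨φ, hφ, 1 / 2, 2, by norm_num, by norm_num, fun s c =>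
    ⟨lower_estimate he hX hm (hd.comp hφ.injective) hI hlow s c,
      upper_estimate he hX hm (fun j => (hx (φ j)).le) hI htail s c⟩⟩

theorem closedComplemented_of_blocks {v : ℕ → (lionsPeetreLattice he hX.1 hm).Elem}
    (hv : ∀ j, ‖v j‖ ≤ 1) (hd : DisjointSeq v)
    {I : ℕ → Finset ℕ} (hI : Pairwise (Function.onFun Disjoint I))
    (hlow : ∀ j, 1 / 2 ≤ partialNorm e X₀ X₁ m (I j) (v j).toFun)
    (htail : ∀ j t, Disjoint t (I j) → partialNorm e X₀ X₁ m t (v j).toFun ≤ 1 / 2 / 2 ^ j) :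
    (Submodule.span ℝ (range v)).topologicalClosure.ClosedComplemented := by
  classical
  have hA : ∀ j, MeasurableSet {t | (v j).toFun t ≠ 0} := fun j =>
    (v j).toFun.measurable (measurableSet_singleton (0 : ℝ)).compl
  -- Norming for the seminorm over $I_j$ rather than the full norm, so that the values on a fixed
  -- `a` can be summed blockwise.
  choose f hf hfle using fun j => (partialSeminorm he hX hm (I j)).exists_dual_eq (v j)
  simp only [partialSeminorm_apply] at hf hfle
  let r : ℕ → ℝ := fun j => partialNorm e X₀ X₁ m (I j) (v j).toFun
  have hr : ∀ j, 0 < r j := fun j => lt_of_lt_of_le (by norm_num) (hlow j)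
  -- Restriction to the support of `v j` annihilates the other `v i`, which makes the system exactly
  -- biorthogonal.
  let g : ℕ → (lionsPeetreLattice he hX.1 hm).Elem →ₗ[ℝ] ℝ := fun j =>
    (r j)⁻¹ • (f j ∘ₗ cutoffₗ _ _ (hA j))
  have hg : ∀ j a, g j a = (r j)⁻¹ * f j (cutoffₗ _ _ (hA j) a) := fun j a => rfl
  have hgle : ∀ j a, |g j a| ≤ 2 * partialNorm e X₀ X₁ m (I j) a.toFun := by
    intro j a
    rw [hg, abs_mul, abs_of_pos (inv_pos.2 (hr j))]
    have h1 : (r j)⁻¹ ≤ 2 := by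
      rw [inv_le_comm₀ (hr j) two_pos, ← one_div]
      exact hlow j
    have h2 := (hfle j (cutoffₗ _ _ (hA j) a)).trans (partialNorm_mono he hm (I j)
      (elem_mem he hX hm a) (abs_cutoff_le (hA := hA j) a.toFun))
    exact mul_le_mul h1 h2 (abs_nonneg _) zero_le_two
  have hsum : ∀ (s : Finset ℕ) (a : (lionsPeetreLattice he hX.1 hm).Elem),
      ‖∑ j ∈ s, g j a • v j‖ ≤ 4 * partialNorm e X₀ X₁ m (s.biUnion I) a.toFun := by
    intro s a
    refine (upper_estimate he hX hm hv hI htail s fun j => g j a).trans ?_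
    have h1 : ‖∑ j ∈ s, g j a • e j‖ ≤
        ‖∑ j ∈ s, (2 * partialNorm e X₀ X₁ m (I j) a.toFun) • e j‖ :=
      he.mono s _ _ fun j _ => (hgle j a).trans (le_abs_self _)
    have h2 : ‖∑ j ∈ s, (2 * partialNorm e X₀ X₁ m (I j) a.toFun) • e j‖ =
        2 * partialNorm e X₀ X₁ m (s.biUnion I) a.toFun := by
      rw [← norm_sum_partialNorm_smul he hI]
      simp_rw [mul_smul]
      rw [← Finset.smul_sum, norm_smul]
      norm_num
    linarith
  refine closedComplemented_span_of_biorthogonal v g (fun i j => ?_) (fun a => ?_) (C := 4)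
    fun s a => (hsum s a).trans ?_
  · rw [hg, hd.cutoffₗ_eq i j]
    split_ifs with hij
    · rw [hij, hf]
      exact inv_mul_cancel₀ (hr j).ne'
    · rw [map_zero, mul_zero]
  · rw [summable_iff_vanishing_norm]
    intro ε hε
    obtain ⟨s₀, hs₀⟩ := exists_partialNorm_lt (elem_mem_wSet he hX hm a)
      (show 0 < ε / 4 by linarith)
    -- Each coordinate lies in at most one block, so finitely many blocks meet `s₀`; the others see
    -- only the tail of `a`.
    have hfin : {j | ∃ n ∈ s₀, n ∈ I j}.Finite := by
      have : {j | ∃ n ∈ s₀, n ∈ I j} = ⋃ n ∈ s₀, {j | n ∈ I j} := by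
        ext j
        simp
      rw [this]
      refine Set.Finite.biUnion s₀.finite_toSet fun n _ => Set.Subsingleton.finite ?_
      intro i hi j hj
      by_contra hij
      exact Finset.disjoint_left.1 (hI hij) hi hj
    refine ⟨hfin.toFinset, fun t ht => (hsum t a).trans_lt ?_⟩
    have h1 := hs₀ (t.biUnion I) (by
      rw [Finset.disjoint_left]
      intro n hn hn0
      obtain ⟨j, hj, hnj⟩ := Finset.mem_biUnion.1 hn
      exact Finset.disjoint_left.1 ht hj (hfin.mem_toFinset.2 ⟨n, hn0, hnj⟩))
    linarith
  · exact mul_le_mul_of_nonneg_left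
      (partialNorm_le_wNorm he (elem_mem_wSet he hX hm a) _) (by norm_num)

theorem isDC_lionsPeetreLattice : (lionsPeetreLattice he hX.1 hm).IsDC := by
  intro x hd
  -- Infinitely many zeros give a subsequence spanning $\{0\}$. Otherwise the sequence is normalized
  -- from some index on, which does not change the spans.
  by_cases h : ∃ᶠ n in atTop, x n = 0
  · obtain ⟨φ, hφ, h0⟩ := extraction_of_frequently_atTop h
    refine ⟨φ, hφ, ?_⟩
    have : range (x ∘ φ) = {0} := by
      ext y
      constructor
      · rintro ⟨n, rfl⟩
        exact h0 n
      · rintro rfl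
        exact ⟨0, h0 0⟩
    rw [this, Submodule.span_singleton_eq_bot.2 rfl]
    refine ⟨0, fun y => ?_⟩
    have hy := y.2
    rw [← SetLike.mem_coe, Submodule.topologicalClosure_coe, Submodule.bot_coe, closure_singleton,
      mem_singleton_iff] at hy
    exact (Subtype.ext hy).symm
  · rw [not_frequently] at h
    obtain ⟨N, hN⟩ := eventually_atTop.1 h
    have hne : ∀ n, x (n + N) ≠ 0 := fun n => hN _ (Nat.le_add_left _ _)
    have hpos : ∀ n, 0 < ‖x (n + N)‖ := fun n => norm_pos_iff.2 (hne n)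
    set y : ℕ → (lionsPeetreLattice he hX.1 hm).Elem := fun n => ‖x (n + N)‖⁻¹ • x (n + N) with hy
    have hy1 : ∀ n, ‖y n‖ = 1 := fun n => by
      rw [hy, norm_smul, norm_inv, norm_norm, inv_mul_cancel₀ (hpos n).ne']
    have hyd : DisjointSeq y := by
      intro i j hij
      refine AEEqFun.ext ?_
      filter_upwards [hd.ae, AEEqFun.coeFn_inf |(y i).toFun| |(y j).toFun|,
        AEEqFun.coeFn_abs (y i).toFun, AEEqFun.coeFn_abs (y j).toFun,
        AEEqFun.coeFn_zero (α := ℝ) (μ := leb01) (β := ℝ),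
        AEEqFun.coeFn_smul ‖x (i + N)‖⁻¹ (x (i + N)).toFun,
        AEEqFun.coeFn_smul ‖x (j + N)‖⁻¹ (x (j + N)).toFun] with t h1 h2 h3 h4 h5 h6 h7
      have h6' : (y i).toFun t = ‖x (i + N)‖⁻¹ * (x (i + N)).toFun t := h6
      have h7' : (y j).toFun t = ‖x (j + N)‖⁻¹ * (x (j + N)).toFun t := h7
      rw [h2, h3, h4, h5, h6', h7', Pi.zero_apply]
      rcases h1 (i + N) (j + N) (by omega) with h | h
      · rw [h, mul_zero, abs_zero]
        exact inf_eq_left.2 (abs_nonneg _)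
      · rw [h, mul_zero, abs_zero]
        exact inf_eq_right.2 (abs_nonneg _)
    obtain ⟨φ, hφ, I, hI, hlow, htail⟩ := exists_subsequence_blocks_of_disjointSeq he hX hm hy1 hyd
    refine ⟨fun n => φ n + N, fun i j hij => Nat.add_lt_add_right (hφ hij) N, ?_⟩
    have hspan : Submodule.span ℝ (range (x ∘ fun n => φ n + N)) =
        Submodule.span ℝ (range (y ∘ φ)) := by
      refine le_antisymm (Submodule.span_le.2 ?_) (Submodule.span_le.2 ?_)
      · rintro _ ⟨n, rfl⟩
        have : x (φ n + N) = ‖x (φ n + N)‖ • y (φ n) := by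
          rw [hy, smul_inv_smul₀ (hpos _).ne']
        show x (φ n + N) ∈ Submodule.span ℝ (range (y ∘ φ))
        rw [this]
        exact Submodule.smul_mem _ _ (Submodule.subset_span ⟨n, rfl⟩)
      · rintro _ ⟨n, rfl⟩
        exact Submodule.smul_mem _ _ (Submodule.subset_span ⟨n, rfl⟩)
    rw [hspan]
    exact closedComplemented_of_blocks he hX hm (fun j => (hy1 _).le) (hyd.comp hφ.injective) hI
      hlow htail

end Blocks

/-! ### The unit vector bases of $l_p$ and $c_0$ are perfectly homogeneous. -/

theorem norm_sum_lpUnit_rpow {p : ℝ≥0∞} [Fact (1 ≤ p)] (hp : p ≠ ∞) (s : Finset ℕ) (a : ℕ → ℝ) :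
    ‖∑ n ∈ s, a n • lpUnit p n‖ ^ p.toReal = ∑ n ∈ s, |a n| ^ p.toReal := by
  have hp0 : 0 < p.toReal := ENNReal.toReal_pos
    (lt_of_lt_of_le one_pos (Fact.out : 1 ≤ p)).ne' hp
  have h : ∀ n, a n • lpUnit p n = lp.single p n (a n) := fun n => by
    rw [lpUnit, ← lp.single_smul, smul_eq_mul, mul_one]
  simp_rw [h]
  rw [lp.norm_sum_single hp0]
  simp_rw [Real.norm_eq_abs]

theorem perfectlyHomogeneous_lpUnit {p : ℝ≥0∞} [Fact (1 ≤ p)] (hp : p ≠ ∞) :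
    PerfectlyHomogeneous (lpUnit p) := by
  have hp0 : 0 < p.toReal := ENNReal.toReal_pos
    (lt_of_lt_of_le one_pos (Fact.out : 1 ≤ p)).ne' hp
  refine ⟨fun n => ?_, fun s a b hab => ?_, fun I hI s a => ?_⟩
  · have h := norm_sum_lpUnit_rpow hp {n} 1
    simp only [Finset.sum_singleton, Pi.one_apply, one_smul, abs_one, Real.one_rpow] at h
    exact (Real.rpow_left_inj (norm_nonneg _) zero_le_one hp0.ne').1
      (h.trans (Real.one_rpow _).symm)
  · refine (Real.rpow_le_rpow_iff (norm_nonneg _) (norm_nonneg _) hp0).1 ?_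
    rw [norm_sum_lpUnit_rpow hp, norm_sum_lpUnit_rpow hp]
    exact Finset.sum_le_sum fun n hn => Real.rpow_le_rpow (abs_nonneg _) (hab n hn) hp0.le
  · refine (Real.rpow_left_inj (norm_nonneg _) (norm_nonneg _) hp0.ne').1 ?_
    rw [norm_sum_lpUnit_rpow hp, ← Finset.sum_biUnion fun i _ j _ hij => hI hij,
      norm_sum_lpUnit_rpow hp, Finset.sum_biUnion fun i _ j _ hij => hI hij]
    refine Finset.sum_congr rfl fun j _ => ?_
    rw [abs_of_nonneg (norm_nonneg _), norm_sum_lpUnit_rpow hp]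

/-- Describing the norm by its upper bounds avoids finite suprema; the condition $0\le r$ matters
for empty `s`. -/
theorem norm_sum_c0Unit_le_iff (s : Finset ℕ) (a : ℕ → ℝ) (r : ℝ) :
    ‖∑ n ∈ s, a n • c0Unit n‖ ≤ r ↔ 0 ≤ r ∧ ∀ n ∈ s, |a n| ≤ r := by
  have happ : ∀ k, (∑ n ∈ s, a n • c0Unit n) k = if k ∈ s then a k else 0 := by
    intro k
    have h1 : (∑ n ∈ s, a n • c0Unit n) k = ∑ n ∈ s, (a n • c0Unit n) k := by
      induction s using Finset.induction_on with
      | empty => simp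
      | insert i s his ih =>
        rw [Finset.sum_insert his, Finset.sum_insert his, ← ih]
        rfl
    rw [h1, ← Finset.sum_ite_eq s k a]
    refine Finset.sum_congr rfl fun n _ => ?_
    show a n * (Pi.single n 1 : ℕ → ℝ) k = _
    rw [Pi.single_apply]
    split_ifs <;> simp
  constructor
  · refine fun h => ⟨(norm_nonneg _).trans h, fun n hn => ?_⟩
    have h1 := (∑ n ∈ s, a n • c0Unit n).toBCF.norm_coe_le_norm n
    rw [ZeroAtInftyContinuousMap.norm_toBCF_eq_norm] at h1
    have h2 : (∑ n ∈ s, a n • c0Unit n).toBCF n = a n := (happ n).trans (if_pos hn)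
    rw [h2, Real.norm_eq_abs] at h1
    exact h1.trans h
  · rintro ⟨hr, h⟩
    rw [← ZeroAtInftyContinuousMap.norm_toBCF_eq_norm, BoundedContinuousFunction.norm_le hr]
    intro k
    show ‖(∑ n ∈ s, a n • c0Unit n) k‖ ≤ r
    rw [happ]
    split_ifs with hk
    · exact h k hk
    · simpa using hr

theorem perfectlyHomogeneous_c0Unit : PerfectlyHomogeneous c0Unit := by
  refine ⟨fun n => ?_, fun s a b hab => ?_, fun I hI s a => ?_⟩
  · refine eq_of_forall_ge_iff fun r => ?_
    have h := norm_sum_c0Unit_le_iff {n} 1 r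
    simp only [Finset.sum_singleton, Pi.one_apply, one_smul, Finset.mem_singleton, forall_eq,
      abs_one] at h
    rw [h, and_iff_right_iff_imp]
    exact zero_le_one.trans
  · have h := (norm_sum_c0Unit_le_iff s b _).1 le_rfl
    exact (norm_sum_c0Unit_le_iff s a _).2 ⟨h.1, fun n hn => (hab n hn).trans (h.2 n hn)⟩
  · refine eq_of_forall_ge_iff fun r => ?_
    rw [norm_sum_c0Unit_le_iff, ← Finset.sum_biUnion fun i _ j _ hij => hI hij,
      norm_sum_c0Unit_le_iff]
    simp only [abs_norm, norm_sum_c0Unit_le_iff, Finset.mem_biUnion, forall_exists_index, and_imp]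
    refine and_congr_right fun hr => ⟨fun h j hj => ⟨hr, fun n hn => h n j hj hn⟩,
      fun h n j hj hn => (h j hj).2 n hn⟩

end

theorem corollary2 (p : ℝ≥0∞) [Fact (1 ≤ p)] (X₀ X₁ : RISpace)
    (hX : StrictlyEmbedded X₀.toBanachFunctionLattice X₁.toBanachFunctionLattice)
    (m : ℕ → ℝ) (hm : AdmissibleWeights m) :
    (p ≠ ∞ → ∃ W : RISpace,
      IsLionsPeetre W.toBanachFunctionLattice (lpUnit p)
        X₀.toBanachFunctionLattice X₁.toBanachFunctionLattice (fun n => (m n)⁻¹) m ∧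
      W.toBanachFunctionLattice.IsPDH p ∧ W.toBanachFunctionLattice.IsDC) ∧
    (p = ∞ → ∃ W : RISpace,
      IsLionsPeetre W.toBanachFunctionLattice c0Unit
        X₀.toBanachFunctionLattice X₁.toBanachFunctionLattice (fun n => (m n)⁻¹) m ∧
      W.toBanachFunctionLattice.IsPDH p ∧ W.toBanachFunctionLattice.IsDC) := by
  refine ⟨fun hp => ?_, fun hp => ?_⟩
  · have he := perfectlyHomogeneous_lpUnit hp
    exact ⟨lionsPeetreRISpace he hX hm, isLionsPeetre_lionsPeetreLattice he hX.1 hm,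
      ⟨fun _ => disjointlyHomogeneousTo_lionsPeetreLattice he hX hm, fun h => absurd h hp⟩,
      isDC_lionsPeetreLattice he hX hm⟩
  · have he := perfectlyHomogeneous_c0Unit
    exact ⟨lionsPeetreRISpace he hX hm, isLionsPeetre_lionsPeetreLattice he hX.1 hm,
      ⟨fun h => absurd hp h, fun _ => disjointlyHomogeneousTo_lionsPeetreLattice he hX hm⟩,
      isDC_lionsPeetreLattice he hX hm⟩
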